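/- **Setting.** Let $I\subset\mathbb R$ be an open interval, $\alpha<\beta$ with $[\alpha,\beta]\subset I$, and let $D,f\in C^2(I)$ satisfy $D\ge d$ on $I$ for some constant $d>0$; $f(\alpha)=f(\beta)=0$, $f'(\alpha)>0$, $f'(\beta)>0$; $\int_\alpha^\beta f(s)D(s)\,ds=0$; and $\int_\alpha^u f(s)D(s)\,ds>0$ for all $u\in I\setminus\{\alpha,\beta\}$. Put $$G(u)=\int_\alpha^u f(s)D(s)\,ds,\qquad \gamma_0=\int_\alpha^\beta\sqrt{2G(s)}\,D(s)\,ds,\qquad \lambda=\min\Big\{\frac{f'(\alpha)}{D(\alpha)},\frac{f'(\beta)}{D(\beta)}\Big\}.$$ Let $a<b$, and for $\varepsilon>0$ let $$E_\varepsilon[w]=\int_a^b\Big\{\frac{\varepsilon}{2}\,[D(w)w_x]^2+\frac{G(w)}{\varepsilon}\Big\}\,dx .$$ Let $N\ge1$, and let $v:[a,b]\to\{\alpha,\beta\}$ be piecewise constant with exactly $N$ jumps, located at $h_1<\dots<h_N$. Let $r>0$ be such that $h_i+r<h_{i+1}-r$ for $1\le i<N$, $a\le h_1-r$ and $h_N+r\le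 b$. Let $A\in(0,r\sqrt{2\lambda})$ and let $M_1<M_2$ with $[M_1,M_2]\subset I$. For all sufficiently small $\varepsilon>0$ let $u_0^\varepsilon\in H^1(a,b)$ (continuous representative) satisfy $M_1\le u_0^\varepsilon\le M_2$ on $[a,b]$. Assume that $\|u_0^\varepsilon-v\|_{L^1(a,b)}\to0$ as $\varepsilon\to0^+$ and that there is $C>0$ with $$E_\varepsilon[u_0^\varepsilon]\le N\gamma_0+C e^{-A/\varepsilon}$$ for all sufficiently small $\varepsilon>0$. For all sufficiently small $\varepsilon>0$ let $u^\varepsilon$ be a solution, with values in $I$, of $$u_t=\varepsilon^2(D(u)u_x)_x-f(u)\ \text{ in }(a,b)\times(0,\infty),\qquad u_x(a,t)=u_x(b,t)=0\ (t>0),\qquad u(\cdot,0)=u_0^\varepsilon,$$ in the class $C([0,\infty);H^1(a,b))\cap C((0,\infty);H^2(a,b))\cap C^1((0,\infty);L^2(a,b))$. For $K\subset I$ and $w:[a,b]\to I$ let $I_K[w]=w^{-1}(K)=\{x\in[a,b]:w(x)\in K\}$. Let $d(X,Y)\in[0,\infty]$ denote the Hausdorff distance of $X,Y\subset\mathbb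 R$, with $d(\emptyset,\emptyset)=0$ and $d(X,\emptyset)=d(\emptyset,X)=\infty$ for $X\ne\emptyset$. **Theorem.** Let $\delta_1\in(0,r)$, and let $K\subset I\setminus\{\alpha,\beta\}$ be relatively closed in $I$ (for instance closed in $\mathbb R$). Put $$t_\varepsilon(\delta_1)=\inf\big\{t\ge0:\ d\big(I_K[u^\varepsilon(\cdot,t)],\,I_K[u_0^\varepsilon]\big)>\delta_1\big\}\in[0,\infty],\qquad \inf\emptyset=+\infty .$$ Then there is $\varepsilon_0>0$ such that $t_\varepsilon(\delta_1)>\exp(A/\varepsilon)$ for every $\varepsilon\in(0,\varepsilon_0)$. -/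

import Mathlib

open Set Filter Topology MeasureTheory

noncomputable section

namespace AllenCahn

/-! ### Sobolev functions on a compact interval

A Sobolev function on `(a, b)` is represented by its continuous representative, a function
`ℝ → ℝ` of which only the values on `[a, b]` matter. -/

/-- The derivative of `w : [a, b] → ℝ` (one-sided at the end points). -/
def dx (a b : ℝ) (w : ℝ → ℝ) : ℝ → ℝ := derivWithin w (Icc a b)

/-- `w ∈ H¹(a, b)`: `w` is absolutely continuous on `[a, b]` and its derivative, which exists
almost everywhere and is the weak derivative, is square integrable. -/
structure MemH1 (a b : ℝ) (w : ℝ → ℝ) : Prop where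
  absolutelyContinuous : AbsolutelyContinuousOnInterval w a b
  memLp_dx : MemLp (dx a b w) 2 (volume.restrict (Icc a b))

/-- `w ∈ H²(a, b)`: `w ∈ H¹(a, b)` is differentiable on `[a, b]` with `w' ∈ H¹(a, b)`. -/
structure MemH2 (a b : ℝ) (w : ℝ → ℝ) : Prop where
  memH1 : MemH1 a b w
  differentiableOn : DifferentiableOn ℝ w (Icc a b)
  memH1_dx : MemH1 a b (dx a b w)

/-- `‖w - z‖²` in `L²(a, b)`. -/
def l2DistSq (a b : ℝ) (w z : ℝ → ℝ) : ℝ := ∫ x in a..b, (w x - z x) ^ 2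

/-- `‖w - z‖²` in `H¹(a, b)`. -/
def h1DistSq (a b : ℝ) (w z : ℝ → ℝ) : ℝ :=
  l2DistSq a b w z + l2DistSq a b (dx a b w) (dx a b z)

/-- `‖w - z‖²` in `H²(a, b)`. -/
def h2DistSq (a b : ℝ) (w z : ℝ → ℝ) : ℝ :=
  h1DistSq a b w z + l2DistSq a b (dx a b (dx a b w)) (dx a b (dx a b z))

/-! ### Diffusivity, reaction and energy -/

/-- The effective potential `G(u) = ∫_α^u f(s) D(s) ds`. -/
def potential (D f : ℝ → ℝ) (α u : ℝ) : ℝ := ∫ s in α..u, f s * D s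

/-- The standing assumptions on the diffusivity `D`, the reaction `f`, the open interval `I` and
the two pure phases `α < β`. -/
structure Admissible (I : Set ℝ) (α β : ℝ) (D f : ℝ → ℝ) : Prop where
  isOpen : IsOpen I
  ordConnected : I.OrdConnected
  lt : α < β
  Icc_subset : Icc α β ⊆ I
  contDiffOn_D : ContDiffOn ℝ 2 D I
  contDiffOn_f : ContDiffOn ℝ 2 f I
  D_lower : ∃ d : ℝ, 0 < d ∧ ∀ u ∈ I, d ≤ D u
  f_left : f α = 0
  f_right : f β = 0
  deriv_f_left : 0 < deriv f α
  deriv_f_right : 0 < deriv f β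
  integral_eq_zero : ∫ s in α..β, f s * D s = 0
  integral_pos : ∀ u ∈ I, u ≠ α → u ≠ β → 0 < ∫ s in α..u, f s * D s

/-- The energy `E_ε[w] = ∫_a^b { ε/2 [D(w) w_x]² + G(w)/ε } dx`. -/
def energy (D f : ℝ → ℝ) (α a b ε : ℝ) (w : ℝ → ℝ) : ℝ :=
  ∫ x in a..b, (ε / 2 * (D (w x) * dx a b w x) ^ 2 + potential D f α (w x) / ε)

/-- The minimal energy of one transition, `γ₀ = ∫_α^β √(2 G(s)) D(s) ds`. -/
def gammaZero (D f : ℝ → ℝ) (α β : ℝ) : ℝ :=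
  ∫ s in α..β, Real.sqrt (2 * potential D f α s) * D s

/-- `λ = min { f'(α)/D(α), f'(β)/D(β) }`. -/
def lam (D f : ℝ → ℝ) (α β : ℝ) : ℝ := min (deriv f α / D α) (deriv f β / D β)

/-! ### Transition layers -/

/-- `v : [a, b] → {α, β}` is piecewise constant with exactly `N` jumps, located at
`h 0 < h 1 < ⋯ < h (N - 1)`, and `r > 0` is such that the intervals `[h i - r, h i + r]` are
pairwise disjoint and contained in `[a, b]`. -/
structure IsStepFunction (a b α β : ℝ) (N : ℕ) (h : Fin N → ℝ) (r : ℝ) (v : ℝ → ℝ) : Prop where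
  r_pos : 0 < r
  separated : ∀ i j : Fin N, i < j → h i + r < h j - r
  left_le : ∀ i, a ≤ h i - r
  le_right : ∀ i, h i + r ≤ b
  mem_phases : ∀ x ∈ Icc a b, v x = α ∨ v x = β
  const_between : ∀ x ∈ Icc a b, ∀ y ∈ Icc a b, x < y → (∀ i, h i ∉ Icc x y) → v x = v y
  jump : ∀ i, ∀ᶠ x in 𝓝[<] (h i), ∀ᶠ y in 𝓝[>] (h i), v x ≠ v y

/-- The family `(w ε)` has an `N`-transition layer structure (with step function `v` and decay
rate `A`): for small `ε` the function `w ε` is in `H¹(a, b)` and has values in `I`,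
`‖w ε - v‖_{L¹} → 0` as `ε → 0⁺`, and `E_ε[w ε] ≤ N γ₀ + C exp(-A/ε)` for small `ε`. -/
structure HasTransitionLayers (I : Set ℝ) (D f : ℝ → ℝ) (α β a b : ℝ) (N : ℕ) (v : ℝ → ℝ)
    (A : ℝ) (w : ℝ → ℝ → ℝ) : Prop where
  memH1 : ∀ᶠ ε in 𝓝[>] (0 : ℝ), MemH1 a b (w ε) ∧ ∀ x ∈ Icc a b, w ε x ∈ I
  tendsto_L1 : Tendsto (fun ε => ∫ x in a..b, |w ε x - v x|) (𝓝[>] 0) (𝓝 0)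
  energy_le : ∃ C : ℝ, 0 < C ∧ ∀ᶠ ε in 𝓝[>] (0 : ℝ),
    energy D f α a b ε (w ε) ≤ N * gammaZero D f α β + C * Real.exp (-A / ε)

/-! ### The initial boundary value problem -/

/-- `u t x` is a (strong, global in time) solution with values in `I` of
`u_t = ε² (D(u) u_x)_x - f(u)` on `(a, b) × (0, ∞)`, `u_x(a, t) = u_x(b, t) = 0` for `t > 0`, and
`u(·, 0) = u₀`, in the class `C([0, ∞); H¹) ∩ C((0, ∞); H²) ∩ C¹((0, ∞); L²)`. -/
structure IsSolution (I : Set ℝ) (D f : ℝ → ℝ) (a b ε : ℝ) (u₀ : ℝ → ℝ) (u : ℝ → ℝ → ℝ) :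
    Prop where
  mem_I : ∀ t, 0 ≤ t → ∀ x ∈ Icc a b, u t x ∈ I
  initial : ∀ x ∈ Icc a b, u 0 x = u₀ x
  memH1 : ∀ t, 0 ≤ t → MemH1 a b (u t)
  continuous_H1 : ∀ t₀, 0 ≤ t₀ →
    Tendsto (fun t => h1DistSq a b (u t) (u t₀)) (𝓝[Ici 0] t₀) (𝓝 0)
  memH2 : ∀ t, 0 < t → MemH2 a b (u t)
  continuous_H2 : ∀ t₀, 0 < t₀ → Tendsto (fun t => h2DistSq a b (u t) (u t₀)) (𝓝 t₀) (𝓝 0)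
  neumann_left : ∀ t, 0 < t → dx a b (u t) a = 0
  neumann_right : ∀ t, 0 < t → dx a b (u t) b = 0
  /-- The difference quotients in time converge in `L²(a, b)` to the right-hand side. -/
  equation : ∀ t₀, 0 < t₀ →
    Tendsto (fun t => l2DistSq a b (fun x => (u t x - u t₀ x) / (t - t₀))
      (fun x => ε ^ 2 * dx a b (fun y => D (u t₀ y) * dx a b (u t₀) y) x - f (u t₀ x)))
      (𝓝[≠] t₀) (𝓝 0)

/-! ### Interfaces -/

/-- The interface `I_K[w] = w⁻¹(K)` of a function `w` on `[a, b]`. -/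
def interface (a b : ℝ) (K : Set ℝ) (w : ℝ → ℝ) : Set ℝ := {x | x ∈ Icc a b ∧ w x ∈ K}

/-- `inf { t ≥ 0 : d(I_K[u(·, t)], I_K[u₀]) > δ }`, with `d` the Hausdorff distance (with values
in `[0, ∞]`) and the infimum in `[-∞, ∞]`; it is `+∞` if there is no such `t`. -/
def exitTime (a b : ℝ) (K : Set ℝ) (δ : ℝ) (u₀ : ℝ → ℝ) (u : ℝ → ℝ → ℝ) : EReal :=
  sInf ((fun t : ℝ => (t : EReal)) '' {t : ℝ | 0 ≤ t ∧
    ENNReal.ofReal δ < Metric.hausdorffEDist (interface a b K (u t)) (interface a b K u₀)})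

end AllenCahn

end

namespace AllenCahn

/-! The proof combines a sharp lower bound for the energy near `v` with the dissipation of energy
along the flow.

Static part. Let `F = calib`, so `F' = √(2G) D`, `F α = 0` and `F β = γ₀`. Young's inequality bounds
`|F(w)_x|` by the energy density, so every passage between the phases costs about `γ₀`. To make the
error exponentially small, `F(w)` is multiplied by a weight `τ = tanh(k (x - c) / ε)`: the part `G
(1 - τ²) / ε` of the density not used by Young's inequality pays for `F(w) τ'` as soon as `k F ≤ G`.
Near `α` this holds with `k = √(λ/2)` because `f'(α) > 0`, and near `β` the same is true of `γ₀ -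
F`. A tail of length `ℓ` then loses only a multiple of `exp(-√(2λ) ℓ / ε)`. Summing over the
disjoint layers gives `exists_energy_lower_bound`: every `w` that is `L¹`-close to `v` has energy at
least `N γ₀ - C exp(-A / ε)`.

Dynamic part. Energy dissipates at rate at least `(1/ε) ∫ D(u) u_t²`, so the `L¹` path travelled is
controlled by elapsed time and energy drop (`integral_abs_sub_le`, with a free parameter `c`). While
`u` stays `L¹`-close to `v`, the initial bound and the static bound leave a drop of at most a
multiple of `exp(-A / ε)`; with `c = √ε exp(-A / ε)` the path up to time `2 exp(A / ε)` is `O(√ε)`.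
A continuity argument closes the loop (`eventually_persist`).

Geometric part. If `w` is `L¹`-close to `v` with energy at most `N γ₀ + σ`, the layers use up almost
all of the energy, so `w` cannot overshoot `[α, β]` noticeably or leave the phases away from the
jumps (`exists_localization`). Hence its interface lies near the jumps, and it meets a neighbourhood
of each jump if `K` meets `(α, β)`. Applied at times `0` and `t`, this bounds the Hausdorff distance
(`exists_hausdorffEDist_interface_le`). -/

theorem hasDerivAt_integral_of_continuousOn {I : Set ℝ} (hI : IsOpen I) (hI' : I.OrdConnected)
    {g : ℝ → ℝ} (hg : ContinuousOn g I) {c u : ℝ} (hc : c ∈ I) (hu : u ∈ I) :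
    HasDerivAt (fun x => ∫ s in c..x, g s) (g u) u :=
  intervalIntegral.integral_hasDerivAt_right
    ((hg.mono (hI'.uIcc_subset hc hu)).intervalIntegrable)
    (hg.stronglyMeasurableAtFilter hI u hu) (hg.continuousAt (hI.mem_nhds hu))

/-- The calibration function `F(u) = ∫_α^u √(2 G(s)) D(s) ds`. -/
noncomputable def calib (D f : ℝ → ℝ) (α u : ℝ) : ℝ :=
  ∫ s in α..u, Real.sqrt (2 * potential D f α s) * D s

theorem calib_right (D f : ℝ → ℝ) (α β : ℝ) : calib D f α β = gammaZero D f α β := rfl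

@[simp] theorem calib_left (D f : ℝ → ℝ) (α : ℝ) : calib D f α α = 0 := by simp [calib]

@[simp] theorem potential_left (D f : ℝ → ℝ) (α : ℝ) : potential D f α α = 0 := by
  simp [potential]

/-! ### The potential and the calibration function near the two wells -/

namespace Admissible

variable {I : Set ℝ} {α β : ℝ} {D f : ℝ → ℝ}

theorem left_mem (h : Admissible I α β D f) : α ∈ I := h.Icc_subset (left_mem_Icc.2 h.lt.le)

theorem right_mem (h : Admissible I α β D f) : β ∈ I := h.Icc_subset (right_mem_Icc.2 h.lt.le)

theorem D_pos (h : Admissible I α β D f) {u : ℝ} (hu : u ∈ I) : 0 < D u := by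
  obtain ⟨d, hd, hD⟩ := h.D_lower
  exact hd.trans_le (hD u hu)

theorem continuousOn_D (h : Admissible I α β D f) : ContinuousOn D I := h.contDiffOn_D.continuousOn

theorem continuousOn_f (h : Admissible I α β D f) : ContinuousOn f I := h.contDiffOn_f.continuousOn

theorem hasDerivAt_f (h : Admissible I α β D f) {u : ℝ} (hu : u ∈ I) :
    HasDerivAt f (deriv f u) u :=
  ((h.contDiffOn_f.contDiffAt (h.isOpen.mem_nhds hu)).differentiableAt (by norm_num)).hasDerivAt

theorem continuousAt_deriv_f (h : Admissible I α β D f) {u : ℝ} (hu : u ∈ I) :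
    ContinuousAt (deriv f) u :=
  (h.contDiffOn_f.continuousOn_deriv_of_isOpen h.isOpen (by norm_num)).continuousAt
    (h.isOpen.mem_nhds hu)

theorem hasDerivAt_potential (h : Admissible I α β D f) {u : ℝ} (hu : u ∈ I) :
    HasDerivAt (potential D f α) (f u * D u) u :=
  hasDerivAt_integral_of_continuousOn h.isOpen h.ordConnected
    (h.continuousOn_f.mul h.continuousOn_D) h.left_mem hu

theorem continuousOn_potential (h : Admissible I α β D f) : ContinuousOn (potential D f α) I :=
  fun _ hu => (h.hasDerivAt_potential hu).continuousAt.continuousWithinAt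

@[simp] theorem potential_right (h : Admissible I α β D f) : potential D f α β = 0 :=
  h.integral_eq_zero

theorem potential_pos (h : Admissible I α β D f) {u : ℝ} (hu : u ∈ I) (h1 : u ≠ α) (h2 : u ≠ β) :
    0 < potential D f α u := h.integral_pos u hu h1 h2

theorem potential_nonneg (h : Admissible I α β D f) {u : ℝ} (hu : u ∈ I) :
    0 ≤ potential D f α u := by
  by_cases h1 : u = α
  · simp [h1]
  by_cases h2 : u = β
  · simp [h2, h.potential_right]
  exact (h.potential_pos hu h1 h2).le

theorem continuousOn_sqrt_mul (h : Admissible I α β D f) :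
    ContinuousOn (fun s => Real.sqrt (2 * potential D f α s) * D s) I :=
  ((continuousOn_const.mul h.continuousOn_potential).sqrt).mul h.continuousOn_D

theorem hasDerivAt_calib (h : Admissible I α β D f) {u : ℝ} (hu : u ∈ I) :
    HasDerivAt (calib D f α) (Real.sqrt (2 * potential D f α u) * D u) u :=
  hasDerivAt_integral_of_continuousOn h.isOpen h.ordConnected h.continuousOn_sqrt_mul h.left_mem hu

theorem contDiffOn_calib (h : Admissible I α β D f) : ContDiffOn ℝ 1 (calib D f α) I := by
  rw [show (1 : WithTop ℕ∞) = 0 + 1 by norm_num, contDiffOn_succ_iff_deriv_of_isOpen h.isOpen]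
  refine ⟨fun u hu => (h.hasDerivAt_calib hu).differentiableAt.differentiableWithinAt, by simp, ?_⟩
  rw [contDiffOn_zero]
  exact h.continuousOn_sqrt_mul.congr fun u hu => (h.hasDerivAt_calib hu).deriv

/-- The integrand `√(2G) D` is nonnegative and vanishes only at `α` and `β`, so every interval
contains a point where it is positive. -/
theorem strictMonoOn_calib (h : Admissible I α β D f) : StrictMonoOn (calib D f α) I := by
  intro x hx y hy hxy
  have hsub : Icc x y ⊆ I := h.ordConnected.out hx hy
  have hint : calib D f α y - calib D f α x
      = ∫ s in x..y, Real.sqrt (2 * potential D f α s) * D s := by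
    rw [intervalIntegral.integral_eq_sub_of_hasDerivAt
      (fun s hs => h.hasDerivAt_calib (h.ordConnected.uIcc_subset hx hy hs))
      ((h.continuousOn_sqrt_mul.mono (h.ordConnected.uIcc_subset hx hy)).intervalIntegrable)]
  have hcont := h.continuousOn_sqrt_mul.mono hsub
  obtain ⟨z, hz, hzαβ⟩ : (Ioo x y \ {α, β}).Nonempty :=
    ((Ioo_infinite hxy).sdiff (toFinite _)).nonempty
  simp only [mem_insert_iff, mem_singleton_iff, not_or] at hzαβ
  have hpos := intervalIntegral.integral_pos hxy hcont
    (fun s hs => mul_nonneg (Real.sqrt_nonneg _) (h.D_pos (hsub (Ioc_subset_Icc_self hs))).le)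
    ⟨z, Ioo_subset_Icc_self hz, mul_pos (Real.sqrt_pos.2 (mul_pos two_pos
      (h.potential_pos (hsub (Ioo_subset_Icc_self hz)) hzαβ.1 hzαβ.2)))
      (h.D_pos (hsub (Ioo_subset_Icc_self hz)))⟩
  linarith

theorem gammaZero_pos (h : Admissible I α β D f) : 0 < gammaZero D f α β := by
  have := h.strictMonoOn_calib h.left_mem h.right_mem h.lt
  rwa [calib_left, calib_right] at this

theorem lam_pos (h : Admissible I α β D f) : 0 < lam D f α β :=
  lt_min (div_pos h.deriv_f_left (h.D_pos h.left_mem))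
    (div_pos h.deriv_f_right (h.D_pos h.right_mem))

/-- At `c` even `λ D ≤ f'` holds, so the factor 2 makes the inequality strict there and continuity
spreads it. The 2 is the one that appears in `(f²)' = 2 f f'`. -/
theorem exists_Icc_subset_deriv_gt (h : Admissible I α β D f) {c : ℝ} (hc : c ∈ I)
    (hlam : lam D f α β ≤ deriv f c / D c) :
    ∃ ρ > 0, ∀ u ∈ Icc (c - ρ) (c + ρ), u ∈ I ∧ lam D f α β * D u ≤ 2 * deriv f u := by
  have hlt : lam D f α β * D c < 2 * deriv f c := by
    have := h.D_pos hc
    rw [le_div_iff₀ this] at hlam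
    nlinarith [mul_pos h.lam_pos this]
  have hev : ∀ᶠ u in 𝓝 c, u ∈ I ∧ lam D f α β * D u < 2 * deriv f u :=
    (h.isOpen.eventually_mem hc).and
      (((h.continuousOn_D.continuousAt (h.isOpen.mem_nhds hc)).const_mul _).eventually_lt
        ((h.continuousAt_deriv_f hc).const_mul _) hlt)
  obtain ⟨ρ, hρ, hball⟩ := Metric.eventually_nhds_iff.1 hev
  refine ⟨ρ / 2, half_pos hρ, fun u hu => ?_⟩
  have := hball (show dist u c < ρ by
    rw [Real.dist_eq, abs_lt]; constructor <;> linarith [hu.1, hu.2])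
  exact ⟨this.1, this.2.le⟩

theorem sqrt_half_lam_mul_sqrt (h : Admissible I α β D f) (g : ℝ) :
    Real.sqrt (lam D f α β / 2) * Real.sqrt (2 * g) = Real.sqrt (lam D f α β * g) := by
  rw [← Real.sqrt_mul (by linarith [h.lam_pos])]
  ring_nf

/-- Two comparisons of derivatives from `α`, where all the functions vanish. The claim reduces to
`√(λG) ≤ f`, that is `λ G ≤ f²`, and this in turn to `λ f D ≤ 2 f f'`. There is slack: the ratio `G
/ F` tends to `√(f'(α) / D(α)) ≥ √λ` at the well. -/
theorem exists_calib_le_potential_left (h : Admissible I α β D f) :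
    ∃ ρ > 0, ∀ u ∈ Icc α (α + ρ), u ∈ I ∧
      Real.sqrt (lam D f α β / 2) * calib D f α u ≤ potential D f α u := by
  obtain ⟨ρ, hρ, hd⟩ := h.exists_Icc_subset_deriv_gt h.left_mem (min_le_left _ _)
  have hI : ∀ u ∈ Icc α (α + ρ), u ∈ I ∧ lam D f α β * D u ≤ 2 * deriv f u :=
    fun u hu => hd u ⟨by linarith [hu.1], hu.2⟩
  have hmem : α ∈ Icc α (α + ρ) := left_mem_Icc.2 (by linarith)
  have hf0 : ∀ u ∈ Icc α (α + ρ), 0 ≤ f u := by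
    have hmono : MonotoneOn f (Icc α (α + ρ)) := by
      refine monotoneOn_of_deriv_nonneg (convex_Icc _ _) (h.continuousOn_f.mono fun u hu =>
        (hI u hu).1) (fun u hu => ?_) fun u hu => ?_
      · exact (h.hasDerivAt_f (hI u (interior_subset hu)).1).differentiableAt.differentiableWithinAt
      · have := hI u (interior_subset hu)
        nlinarith [mul_pos h.lam_pos (h.D_pos this.1)]
    intro u hu
    have := hmono hmem hu hu.1
    rwa [h.f_left] at this
  have hfG : ∀ u ∈ Icc α (α + ρ), lam D f α β * potential D f α u ≤ f u ^ 2 := by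
    have hder : ∀ u ∈ Icc α (α + ρ), HasDerivAt
        (fun u => f u ^ 2 - lam D f α β * potential D f α u)
        (2 * f u * deriv f u - lam D f α β * (f u * D u)) u := fun u hu =>
      (((h.hasDerivAt_f (hI u hu).1).pow 2).sub
        ((h.hasDerivAt_potential (hI u hu).1).const_mul (lam D f α β))).congr_deriv (by simp)
    have hmono : MonotoneOn (fun u => f u ^ 2 - lam D f α β * potential D f α u)
        (Icc α (α + ρ)) := by
      refine monotoneOn_of_deriv_nonneg (convex_Icc _ _)
        (fun u hu => (hder u hu).continuousAt.continuousWithinAt)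
        (fun u hu => (hder u (interior_subset hu)).differentiableAt.differentiableWithinAt)
        fun u hu => ?_
      rw [(hder u (interior_subset hu)).deriv]
      nlinarith [mul_nonneg (hf0 u (interior_subset hu))
        (sub_nonneg.2 (hI u (interior_subset hu)).2)]
    intro u hu
    have := hmono hmem hu hu.1
    simp only [h.f_left, potential_left] at this
    linarith
  refine ⟨ρ, hρ, fun u hu => ⟨(hI u hu).1, ?_⟩⟩
  have hder : ∀ u ∈ Icc α (α + ρ), HasDerivAt
      (fun u => potential D f α u - Real.sqrt (lam D f α β / 2) * calib D f α u)
      (f u * D u - Real.sqrt (lam D f α β / 2) * (Real.sqrt (2 * potential D f α u) * D u)) u :=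
    fun u hu => (h.hasDerivAt_potential (hI u hu).1).sub
        ((h.hasDerivAt_calib (hI u hu).1).const_mul _)
  have hmono : MonotoneOn
      (fun u => potential D f α u - Real.sqrt (lam D f α β / 2) * calib D f α u)
      (Icc α (α + ρ)) := by
    refine monotoneOn_of_deriv_nonneg (convex_Icc _ _)
      (fun u hu => (hder u hu).continuousAt.continuousWithinAt)
      (fun u hu => (hder u (interior_subset hu)).differentiableAt.differentiableWithinAt)
      fun u hu => ?_
    have hu := interior_subset hu
    rw [(hder u hu).deriv, ← mul_assoc, h.sqrt_half_lam_mul_sqrt, ← sub_mul]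
    exact mul_nonneg (sub_nonneg.2 ((Real.sqrt_le_left (hf0 u hu)).2 (hfG u hu)))
      (h.D_pos (hI u hu).1).le
  have := hmono hmem hu hu.1
  simp only [potential_left, calib_left] at this
  linarith

theorem exists_calib_le_potential_right (h : Admissible I α β D f) :
    ∃ ρ > 0, ∀ u ∈ Icc (β - ρ) β, u ∈ I ∧
      Real.sqrt (lam D f α β / 2) * (gammaZero D f α β - calib D f α u) ≤ potential D f α u := by
  obtain ⟨ρ, hρ, hd⟩ := h.exists_Icc_subset_deriv_gt h.right_mem (min_le_right _ _)
  have hI : ∀ u ∈ Icc (β - ρ) β, u ∈ I ∧ lam D f α β * D u ≤ 2 * deriv f u :=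
    fun u hu => hd u ⟨hu.1, by linarith [hu.2]⟩
  have hmem : β ∈ Icc (β - ρ) β := right_mem_Icc.2 (by linarith)
  have hf0 : ∀ u ∈ Icc (β - ρ) β, f u ≤ 0 := by
    have hmono : MonotoneOn f (Icc (β - ρ) β) := by
      refine monotoneOn_of_deriv_nonneg (convex_Icc _ _) (h.continuousOn_f.mono fun u hu =>
        (hI u hu).1) (fun u hu => ?_) fun u hu => ?_
      · exact (h.hasDerivAt_f (hI u (interior_subset hu)).1).differentiableAt.differentiableWithinAt
      · have := hI u (interior_subset hu)
        nlinarith [mul_pos h.lam_pos (h.D_pos this.1)]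
    intro u hu
    have := hmono hu hmem hu.2
    rwa [h.f_right] at this
  have hfG : ∀ u ∈ Icc (β - ρ) β, lam D f α β * potential D f α u ≤ (-f u) ^ 2 := by
    have hder : ∀ u ∈ Icc (β - ρ) β, HasDerivAt
        (fun u => f u ^ 2 - lam D f α β * potential D f α u)
        (2 * f u * deriv f u - lam D f α β * (f u * D u)) u := fun u hu =>
      (((h.hasDerivAt_f (hI u hu).1).pow 2).sub
        ((h.hasDerivAt_potential (hI u hu).1).const_mul (lam D f α β))).congr_deriv (by simp)
    have hmono : AntitoneOn (fun u => f u ^ 2 - lam D f α β * potential D f α u)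
        (Icc (β - ρ) β) := by
      refine antitoneOn_of_deriv_nonpos (convex_Icc _ _)
        (fun u hu => (hder u hu).continuousAt.continuousWithinAt)
        (fun u hu => (hder u (interior_subset hu)).differentiableAt.differentiableWithinAt)
        fun u hu => ?_
      rw [(hder u (interior_subset hu)).deriv]
      nlinarith [mul_nonneg (neg_nonneg.2 (hf0 u (interior_subset hu)))
        (sub_nonneg.2 (hI u (interior_subset hu)).2)]
    intro u hu
    have := hmono hu hmem hu.2
    simp only [h.f_right, h.potential_right] at this
    linarith
  refine ⟨ρ, hρ, fun u hu => ⟨(hI u hu).1, ?_⟩⟩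
  have hder : ∀ u ∈ Icc (β - ρ) β, HasDerivAt
      (fun u => potential D f α u + Real.sqrt (lam D f α β / 2) * calib D f α u)
      (f u * D u + Real.sqrt (lam D f α β / 2) * (Real.sqrt (2 * potential D f α u) * D u)) u :=
    fun u hu => (h.hasDerivAt_potential (hI u hu).1).add
        ((h.hasDerivAt_calib (hI u hu).1).const_mul _)
  have hmono : AntitoneOn
      (fun u => potential D f α u + Real.sqrt (lam D f α β / 2) * calib D f α u)
      (Icc (β - ρ) β) := by
    refine antitoneOn_of_deriv_nonpos (convex_Icc _ _)
      (fun u hu => (hder u hu).continuousAt.continuousWithinAt)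
      (fun u hu => (hder u (interior_subset hu)).differentiableAt.differentiableWithinAt)
      fun u hu => ?_
    have hu := interior_subset hu
    rw [(hder u hu).deriv, ← mul_assoc, h.sqrt_half_lam_mul_sqrt, ← add_mul]
    refine mul_nonpos_of_nonpos_of_nonneg ?_ (h.D_pos (hI u hu).1).le
    linarith [(Real.sqrt_le_left (neg_nonneg.2 (hf0 u hu))).2 (hfG u hu)]
  have := hmono hu hmem hu.2
  simp only [h.potential_right, calib_right D f α β] at this
  linarith

/-- Energy estimates only control `F(w)`; strict monotonicity of `F` turns that control back into
control of `w`. The comparison points `c ± η` are pulled in so as to stay inside `I`. -/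
theorem exists_lt_of_calib (h : Admissible I α β D f) {c η : ℝ} (hc : c ∈ I) (hη : 0 < η) :
    ∃ κ > 0, ∀ u ∈ I, (calib D f α c - κ < calib D f α u → c - η < u) ∧
      (calib D f α u < calib D f α c + κ → u < c + η) := by
  obtain ⟨ρ, hρ, hball⟩ := Metric.isOpen_iff.1 h.isOpen c hc
  have hl : c - min η (ρ / 2) ∈ I := hball (by
    rw [Metric.mem_ball, Real.dist_eq, abs_lt]
    constructor <;> linarith [min_le_right η (ρ / 2), lt_min hη (half_pos hρ)])
  have hr : c + min η (ρ / 2) ∈ I := hball (by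
    rw [Metric.mem_ball, Real.dist_eq, abs_lt]
    constructor <;> linarith [min_le_right η (ρ / 2), lt_min hη (half_pos hρ)])
  have hm := lt_min hη (half_pos hρ)
  have hl' := h.strictMonoOn_calib hl hc (by linarith)
  have hr' := h.strictMonoOn_calib hc hr (by linarith)
  refine ⟨min (calib D f α c - calib D f α (c - min η (ρ / 2)))
    (calib D f α (c + min η (ρ / 2)) - calib D f α c), lt_min (by linarith) (by linarith),
    fun u hu => ⟨fun hlt => ?_, fun hlt => ?_⟩⟩
  · have : calib D f α (c - min η (ρ / 2)) < calib D f α u := by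
      linarith [min_le_left (calib D f α c - calib D f α (c - min η (ρ / 2)))
        (calib D f α (c + min η (ρ / 2)) - calib D f α c)]
    have := (h.strictMonoOn_calib.lt_iff_lt hl hu).1 this
    linarith [min_le_left η (ρ / 2)]
  · have : calib D f α u < calib D f α (c + min η (ρ / 2)) := by
      linarith [min_le_right (calib D f α c - calib D f α (c - min η (ρ / 2)))
        (calib D f α (c + min η (ρ / 2)) - calib D f α c)]
    have := (h.strictMonoOn_calib.lt_iff_lt hu hr).1 this
    linarith [min_le_left η (ρ / 2)]

theorem exists_abs_calib_sub_le (h : Admissible I α β D f) {c θ : ℝ} (hc : c ∈ I) (hθ : 0 < θ) :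
    ∃ σ > 0, ∀ u, |u - c| ≤ σ → |calib D f α u - calib D f α c| ≤ θ := by
  obtain ⟨σ, hσ, hb⟩ := Metric.continuousAt_iff.1 (h.hasDerivAt_calib hc).continuousAt θ hθ
  refine ⟨σ / 2, half_pos hσ, fun u hu => ?_⟩
  have := hb (show dist u c < σ by rw [Real.dist_eq]; linarith)
  rw [Real.dist_eq] at this
  exact this.le

/-- The one-sided estimates at the wells, with the neighbourhoods expressed through the value of
`F`. In this form they apply to `F` and to `γ₀ - F` alike. -/
theorem exists_well_estimate (h : Admissible I α β D f) :
    ∃ η > 0, ∀ u ∈ I,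
      (0 ≤ calib D f α u → calib D f α u ≤ η →
        Real.sqrt (lam D f α β / 2) * calib D f α u ≤ potential D f α u) ∧
      (0 ≤ gammaZero D f α β - calib D f α u → gammaZero D f α β - calib D f α u ≤ η →
        Real.sqrt (lam D f α β / 2) * (gammaZero D f α β - calib D f α u)
          ≤ potential D f α u) := by
  obtain ⟨ρ₁, hρ₁, h1⟩ := h.exists_calib_le_potential_left
  obtain ⟨ρ₂, hρ₂, h2⟩ := h.exists_calib_le_potential_right
  obtain ⟨κ₁, hκ₁, h3⟩ := h.exists_lt_of_calib h.left_mem hρ₁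
  obtain ⟨κ₂, hκ₂, h4⟩ := h.exists_lt_of_calib h.right_mem hρ₂
  have hmin := lt_min hκ₁ hκ₂
  refine ⟨min κ₁ κ₂ / 2, by positivity, fun u hu => ⟨fun h0 hle => ?_, fun h0 hle => ?_⟩⟩
  · refine (h1 u ⟨?_, ?_⟩).2
    · rw [← calib_left D f α] at h0
      exact (h.strictMonoOn_calib.le_iff_le h.left_mem hu).1 h0
    · refine ((h3 u hu).2 ?_).le
      rw [calib_left]
      linarith [min_le_left κ₁ κ₂]
  · refine (h2 u ⟨?_, ?_⟩).2
    · refine ((h4 u hu).1 ?_).le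
      rw [calib_right]
      linarith [min_le_right κ₁ κ₂]
    · rw [← calib_right D f α β, sub_nonneg] at h0
      exact (h.strictMonoOn_calib.le_iff_le hu h.right_mem).1 h0

end Admissible

end AllenCahn

/-! ### Lipschitz composition and the hyperbolic tangent -/

theorem LipschitzOnWith.comp_absolutelyContinuousOnInterval {φ w : ℝ → ℝ} {C : NNReal} {S : Set ℝ}
    {a b : ℝ} (hφ : LipschitzOnWith C φ S) (hw : AbsolutelyContinuousOnInterval w a b)
    (hS : ∀ x ∈ uIcc a b, w x ∈ S) : AbsolutelyContinuousOnInterval (fun x => φ (w x)) a b := by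
  rw [absolutelyContinuousOnInterval_iff] at hw ⊢
  intro ε hε
  -- `C + 1` instead of `C`, since `C` may be zero.
  obtain ⟨δ, hδ, h⟩ := hw (ε / (C + 1)) (by positivity)
  refine ⟨δ, hδ, fun E hE hlt => ?_⟩
  have h1 := h E hE hlt
  rw [lt_div_iff₀ (by positivity)] at h1
  calc ∑ i ∈ Finset.range E.1, dist (φ (w (E.2 i).1)) (φ (w (E.2 i).2))
      ≤ ∑ i ∈ Finset.range E.1, C * dist (w (E.2 i).1) (w (E.2 i).2) :=
        Finset.sum_le_sum fun i hi => hφ.dist_le_mul _ (hS _ (hE.1 i hi).1) _ (hS _ (hE.1 i hi).2)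
    _ = (∑ i ∈ Finset.range E.1, dist (w (E.2 i).1) (w (E.2 i).2)) * C := by
        rw [← Finset.mul_sum, mul_comm]
    _ ≤ (∑ i ∈ Finset.range E.1, dist (w (E.2 i).1) (w (E.2 i).2)) * (C + 1) := by
        gcongr
        linarith
    _ < ε := h1

theorem Real.hasDerivAt_tanh (x : ℝ) : HasDerivAt Real.tanh (1 - Real.tanh x ^ 2) x := by
  have h : Real.tanh = fun x => Real.sinh x / Real.cosh x := funext Real.tanh_eq_sinh_div_cosh
  rw [h]
  refine ((Real.hasDerivAt_sinh x).div (Real.hasDerivAt_cosh x)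
    (Real.cosh_pos x).ne').congr_deriv ?_
  have := (Real.cosh_pos x).ne'
  field_simp

theorem Real.contDiff_tanh {n : WithTop ℕ∞} : ContDiff ℝ n Real.tanh := by
  have h : Real.tanh = fun x => Real.sinh x / Real.cosh x := funext Real.tanh_eq_sinh_div_cosh
  rw [h]
  exact Real.contDiff_sinh.div Real.contDiff_cosh fun x => (Real.cosh_pos x).ne'

/-- This is the source of every exponentially small error below. -/
theorem Real.one_sub_tanh_le (x : ℝ) : 1 - Real.tanh x ≤ 2 * Real.exp (-(2 * x)) := by
  rw [Real.tanh_eq, sub_le_iff_le_add, ← sub_le_iff_le_add',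
    le_div_iff₀ (by positivity)]
  have h1 : Real.exp (-(2 * x)) * Real.exp x = Real.exp (-x) := by
    rw [← Real.exp_add]; ring_nf
  nlinarith [mul_pos (Real.exp_pos (-(2 * x))) (Real.exp_pos (-x))]

/-! ### Weighted calibration and the energy of one transition -/

namespace AllenCahn

/-- The energy density `ε/2 [D(w) w_x]² + G(w)/ε`. -/
noncomputable def density (D f : ℝ → ℝ) (α a b ε : ℝ) (w : ℝ → ℝ) (x : ℝ) : ℝ :=
  ε / 2 * (D (w x) * dx a b w x) ^ 2 + potential D f α (w x) / ε

theorem energy_eq_integral_density (D f : ℝ → ℝ) (α a b ε : ℝ) (w : ℝ → ℝ) :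
    energy D f α a b ε w = ∫ x in a..b, density D f α a b ε w x := rfl

theorem dx_eq_deriv {a b x : ℝ} (hx : x ∈ Ioo a b) (w : ℝ → ℝ) : dx a b w x = deriv w x :=
  derivWithin_of_mem_nhds (Icc_mem_nhds hx.1 hx.2)

section
variable {a b : ℝ} {w : ℝ → ℝ} {I : Set ℝ}

theorem MemH1.continuousOn (hab : a ≤ b) (hw : MemH1 a b w) : ContinuousOn w (Icc a b) := by
  have := hw.absolutelyContinuous.continuousOn
  rwa [uIcc_of_le hab] at this

theorem exists_Icc_of_continuousOn (hab : a ≤ b) (hI : I.OrdConnected)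
    (hw : ContinuousOn w (Icc a b)) (hwI : ∀ x ∈ Icc a b, w x ∈ I) :
    ∃ m M, m ≤ M ∧ Icc m M ⊆ I ∧ ∀ x ∈ Icc a b, w x ∈ Icc m M := by
  obtain ⟨x, hx, hmin⟩ := isCompact_Icc.exists_isMinOn (nonempty_Icc.2 hab) hw
  obtain ⟨y, hy, hmax⟩ := isCompact_Icc.exists_isMaxOn (nonempty_Icc.2 hab) hw
  exact ⟨w x, w y, hmin hy, hI.out (hwI x hx) (hwI y hy), fun z hz => ⟨hmin hz, hmax hz⟩⟩

theorem MemH1.absolutelyContinuous_comp (hab : a ≤ b) (hI : I.OrdConnected) (hw : MemH1 a b w)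
    (hwI : ∀ x ∈ Icc a b, w x ∈ I) {φ : ℝ → ℝ} (hφ : ContDiffOn ℝ 1 φ I) :
    AbsolutelyContinuousOnInterval (fun x => φ (w x)) a b := by
  obtain ⟨m, M, -, hsub, hmem⟩ := exists_Icc_of_continuousOn hab hI (hw.continuousOn hab) hwI
  obtain ⟨C, hC⟩ := (hφ.mono hsub).exists_lipschitzOnWith one_ne_zero (convex_Icc m M) isCompact_Icc
  refine hC.comp_absolutelyContinuousOnInterval hw.absolutelyContinuous ?_
  rwa [uIcc_of_le hab]

theorem _root_.MeasureTheory.MemLp.continuousOn_mul {p : ENNReal} {g φ : ℝ → ℝ}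
    (hg : MemLp g p (volume.restrict (Icc a b))) (hφ : ContinuousOn φ (Icc a b)) :
    MemLp (fun x => φ x * g x) p (volume.restrict (Icc a b)) := by
  obtain ⟨C, hC⟩ := isCompact_Icc.exists_bound_of_continuousOn hφ
  refine hg.of_le_mul (c := C)
    ((hφ.aestronglyMeasurable measurableSet_Icc).mul hg.aestronglyMeasurable)
    ((ae_restrict_mem measurableSet_Icc).mono fun x hx => ?_)
  rw [norm_mul]
  exact mul_le_mul_of_nonneg_right (hC x hx) (norm_nonneg _)

theorem intervalIntegrable_iff_restrict_Icc (hab : a ≤ b) {g : ℝ → ℝ} :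
    IntervalIntegrable g volume a b ↔ Integrable g (volume.restrict (Icc a b)) :=
  intervalIntegrable_iff_integrableOn_Icc_of_le hab

end

namespace Admissible

variable {I : Set ℝ} {α β : ℝ} {D f : ℝ → ℝ} {a b ε : ℝ} {w : ℝ → ℝ}

theorem memLp_flux (h : Admissible I α β D f) (hab : a ≤ b) (hw : MemH1 a b w)
    (hwI : ∀ x ∈ Icc a b, w x ∈ I) :
    MemLp (fun x => D (w x) * dx a b w x) 2 (volume.restrict (Icc a b)) :=
  hw.memLp_dx.continuousOn_mul (h.continuousOn_D.comp (hw.continuousOn hab) hwI)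

theorem intervalIntegrable_potential (h : Admissible I α β D f) (hab : a ≤ b) (hw : MemH1 a b w)
    (hwI : ∀ x ∈ Icc a b, w x ∈ I) :
    IntervalIntegrable (fun x => potential D f α (w x)) volume a b := by
  refine ContinuousOn.intervalIntegrable ?_
  rw [uIcc_of_le hab]
  exact h.continuousOn_potential.comp (hw.continuousOn hab) hwI

theorem intervalIntegrable_density (h : Admissible I α β D f) (hab : a ≤ b) (hw : MemH1 a b w)
    (hwI : ∀ x ∈ Icc a b, w x ∈ I) :
    IntervalIntegrable (density D f α a b ε w) volume a b :=
  (((intervalIntegrable_iff_restrict_Icc hab).2 (h.memLp_flux hab hw hwI).integrable_sq).const_mul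
    _).add ((h.intervalIntegrable_potential hab hw hwI).div_const _)

theorem density_nonneg (h : Admissible I α β D f) (hε : 0 < ε) (hwI : ∀ x ∈ Icc a b, w x ∈ I)
    {x : ℝ} (hx : x ∈ Icc a b) : 0 ≤ density D f α a b ε w x := by
  have := h.potential_nonneg (hwI x hx)
  unfold density
  positivity

/-- Integrate `(s(w) τ)'`. By Young's inequality the term `s'(w) w_x τ` is at most `ε/2 (D w_x)² + G
τ² / ε`; the remainder `G (1 - τ²) / ε` of the density absorbs `s(w) τ'`, which is the hypothesis
`hcal`. The function `s` stands for `F` or `γ₀ - F`. -/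
theorem abs_sub_le_integral_density_of_calibration (h : Admissible I α β D f) (hab : a < b)
    (hε : 0 < ε) (hw : MemH1 a b w) (hwI : ∀ x ∈ Icc a b, w x ∈ I) {s s' τ : ℝ → ℝ}
    (hs : ContDiffOn ℝ 1 s I) (hs' : ∀ u ∈ I, HasDerivAt s (s' u) u)
    (hs'_le : ∀ u ∈ I, |s' u| ≤ Real.sqrt (2 * potential D f α u) * D u) (hτ : ContDiff ℝ 1 τ)
    {x₀ x₁ : ℝ} (h0 : a ≤ x₀) (h01 : x₀ ≤ x₁) (h1 : x₁ ≤ b)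
    (hcal : ∀ x ∈ Icc x₀ x₁, |s (w x) * deriv τ x| ≤ potential D f α (w x) * (1 - τ x ^ 2) / ε) :
    |s (w x₁) * τ x₁ - s (w x₀) * τ x₀| ≤ ∫ x in x₀..x₁, density D f α a b ε w x := by
  have hsub : uIcc x₀ x₁ ⊆ uIcc a b := by
    rw [uIcc_of_le h01, uIcc_of_le hab.le]; exact Icc_subset_Icc h0 h1
  have hac := ((hw.absolutelyContinuous_comp hab.le h.ordConnected hwI hs).fun_mul
    hτ.contDiffOn.absolutelyContinuousOnInterval).mono hsub
  have hint := (h.intervalIntegrable_density (ε := ε) hab.le hw hwI).mono_set hsub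
  rw [← hac.integral_deriv_eq_sub]
  refine (intervalIntegral.abs_integral_le_integral_abs h01).trans ?_
  refine intervalIntegral.integral_mono_ae_restrict h01 hac.intervalIntegrable_deriv.abs hint ?_
  have hI : Icc x₀ x₁ ⊆ Icc a b := Icc_subset_Icc h0 h1
  rw [← Measure.restrict_congr_set (Ioo_ae_eq_Icc (μ := volume) (a := x₀) (b := x₁))]
  filter_upwards [ae_restrict_mem measurableSet_Ioo,
    ae_restrict_of_ae hw.absolutelyContinuous.ae_differentiableAt] with x hx hdiff
  have hx' := Ioo_subset_Icc_self hx
  have hxI := hwI x (hI hx')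
  have hdx : dx a b w x = deriv w x := dx_eq_deriv ⟨h0.trans_lt hx.1, hx.2.trans_le h1⟩ w
  have hd : HasDerivAt (fun x => s (w x) * τ x)
      (s' (w x) * deriv w x * τ x + s (w x) * deriv τ x) x :=
    ((hs' _ hxI).comp x (hdiff (by rw [uIcc_of_le hab.le]; exact hI hx')).hasDerivAt).mul
      ((hτ.differentiable one_ne_zero) x).hasDerivAt
  rw [hd.deriv, density, hdx]
  have hG := h.potential_nonneg hxI
  have hq := Real.sq_sqrt (mul_nonneg zero_le_two hG)
  set q := Real.sqrt (2 * potential D f α (w x))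
  have hbound : |s' (w x) * deriv w x * τ x| ≤ q * |D (w x) * deriv w x * τ x| := by
    rw [mul_assoc, mul_assoc, abs_mul, abs_mul (D _), abs_of_pos (h.D_pos hxI), ← mul_assoc]
    exact mul_le_mul_of_nonneg_right (hs'_le _ hxI) (abs_nonneg _)
  have hyoung : q * |D (w x) * deriv w x * τ x| ≤
      ε / 2 * (D (w x) * deriv w x) ^ 2 + potential D f α (w x) * τ x ^ 2 / ε := by
    have h2 : potential D f α (w x) = q ^ 2 / 2 := by linarith
    rw [h2, abs_mul, ← sq_abs (D (w x) * deriv w x), ← sq_abs (τ x)]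
    generalize |D (w x) * deriv w x| = p
    generalize |τ x| = t
    -- Young's inequality, written as a completed square.
    have : ε / 2 * p ^ 2 + q ^ 2 / 2 * t ^ 2 / ε - q * (p * t) = (ε * p - q * t) ^ 2 / (2 * ε) := by
      field_simp
      ring
    have : 0 ≤ (ε * p - q * t) ^ 2 / (2 * ε) := by positivity
    linarith
  have hsum : potential D f α (w x) * τ x ^ 2 / ε + potential D f α (w x) * (1 - τ x ^ 2) / ε
      = potential D f α (w x) / ε := by ring
  linarith [abs_add_le (s' (w x) * deriv w x * τ x) (s (w x) * deriv τ x), hcal x hx']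

theorem integral_density_mono (h : Admissible I α β D f) (hε : 0 < ε) (hab : a ≤ b)
    (hw : MemH1 a b w) (hwI : ∀ x ∈ Icc a b, w x ∈ I) {x₀ x₁ y₀ y₁ : ℝ} (hx : a ≤ x₀)
    (hxy : x₀ ≤ y₀) (hy : y₀ ≤ y₁) (hyx : y₁ ≤ x₁) (hx₁ : x₁ ≤ b) :
    ∫ x in y₀..y₁, density D f α a b ε w x ≤ ∫ x in x₀..x₁, density D f α a b ε w x := by
  refine intervalIntegral.integral_mono_interval hxy hy hyx
    ((ae_restrict_mem measurableSet_Ioc).mono fun x hx' => h.density_nonneg hε hwI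
      ⟨by linarith [hx'.1], by linarith [hx'.2]⟩) ?_
  refine (h.intervalIntegrable_density hab hw hwI).mono_set ?_
  rw [uIcc_of_le hab, uIcc_of_le (by linarith)]
  exact Icc_subset_Icc hx hx₁

/-- The constant weight `τ = 1`: the classical Modica–Mortola bound, without the exponential
refinement. -/
theorem abs_sub_le_integral_density (h : Admissible I α β D f) (hab : a < b)
    (hε : 0 < ε) (hw : MemH1 a b w) (hwI : ∀ x ∈ Icc a b, w x ∈ I) {s s' : ℝ → ℝ}
    (hs : ContDiffOn ℝ 1 s I) (hs' : ∀ u ∈ I, HasDerivAt s (s' u) u)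
    (hs'_le : ∀ u ∈ I, |s' u| ≤ Real.sqrt (2 * potential D f α u) * D u)
    {x₀ x₁ : ℝ} (h0 : a ≤ x₀) (h1 : x₁ ≤ b) {x y : ℝ} (hx : x ∈ Icc x₀ x₁) (hy : y ∈ Icc x₀ x₁) :
    |s (w y) - s (w x)| ≤ ∫ x in x₀..x₁, density D f α a b ε w x := by
  wlog hxy : x ≤ y generalizing x y
  · rw [abs_sub_comm]
    exact this hy hx (le_of_not_ge hxy)
  have := h.abs_sub_le_integral_density_of_calibration hab hε hw hwI hs hs' hs'_le
    (τ := fun _ => 1) contDiff_const (h0.trans hx.1) hxy (hy.2.trans h1) (fun z _ => by simp)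
  simp only [mul_one] at this
  exact this.trans (h.integral_density_mono hε hab.le hw hwI h0 hx.1 hxy hy.2 h1)

/-- The energy of a tail next to a layer. If `s(w)` leaves `[0, η]`, the unweighted bound already
yields `s(w z)`, because `s(w z) ≤ η / 2`. Otherwise `k s ≤ G` holds throughout, and the weight is a
`tanh` centred at the end point opposite to `z`: it kills the boundary term there and is
exponentially close to `±1` at `z`. -/
theorem sub_exp_le_integral_density (h : Admissible I α β D f) (hab : a < b)
    (hε : 0 < ε) (hw : MemH1 a b w) (hwI : ∀ x ∈ Icc a b, w x ∈ I) {s s' : ℝ → ℝ}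
    (hs : ContDiffOn ℝ 1 s I) (hs' : ∀ u ∈ I, HasDerivAt s (s' u) u)
    (hs'_le : ∀ u ∈ I, |s' u| ≤ Real.sqrt (2 * potential D f α u) * D u)
    {k η : ℝ} (hk : 0 < k) (hη : 0 < η)
    (hwell : ∀ u ∈ I, 0 ≤ s u → s u ≤ η → k * s u ≤ potential D f α u)
    {x₀ x₁ ℓ : ℝ} (h0 : a ≤ x₀) (h01 : x₀ ≤ x₁) (h1 : x₁ ≤ b) (hℓ : ℓ ≤ x₁ - x₀) {z : ℝ}
    (hz : z = x₀ ∨ z = x₁) (hsz : s (w z) ≤ η / 2) :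
    s (w z) - η * Real.exp (-(2 * k * ℓ) / ε) ≤ ∫ x in x₀..x₁, density D f α a b ε w x := by
  have hexp := mul_pos hη (Real.exp_pos (-(2 * k * ℓ) / ε))
  have hzmem : z ∈ Icc x₀ x₁ := by rcases hz with rfl | rfl <;> simp [h01]
  by_cases hrange : ∀ x ∈ Icc x₀ x₁, 0 ≤ s (w x) ∧ s (w x) ≤ η
  swap
  · push Not at hrange
    obtain ⟨y, hy, hy'⟩ := hrange
    have habs := h.abs_sub_le_integral_density hab hε hw hwI hs hs' hs'_le h0 h1 hy hzmem
    rcases lt_or_ge (s (w y)) 0 with hneg | hpos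
    · linarith [le_abs_self (s (w z) - s (w y))]
    · linarith [neg_abs_le (s (w z) - s (w y)), hy' hpos]
  have key : ∀ c, |s (w x₁) * Real.tanh (k * (x₁ - c) / ε) - s (w x₀) *
      Real.tanh (k * (x₀ - c) / ε)| ≤ ∫ x in x₀..x₁, density D f α a b ε w x := fun c => by
    refine h.abs_sub_le_integral_density_of_calibration hab hε hw hwI hs hs' hs'_le
      (τ := fun x => Real.tanh (k * (x - c) / ε))
      (Real.contDiff_tanh.comp (by fun_prop)) h0 h01 h1 fun x hx => ?_
    have hd : HasDerivAt (fun x => Real.tanh (k * (x - c) / ε))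
        ((1 - Real.tanh (k * (x - c) / ε) ^ 2) * (k * 1 / ε)) x :=
      (Real.hasDerivAt_tanh _).comp x ((((hasDerivAt_id x).sub_const c).const_mul k).div_const ε)
    have hτ : 0 ≤ 1 - Real.tanh (k * (x - c) / ε) ^ 2 := by
      nlinarith [Real.tanh_lt_one (k * (x - c) / ε), Real.neg_one_lt_tanh (k * (x - c) / ε)]
    have hsx := hrange x hx
    have hxI := hwI x ⟨h0.trans hx.1, hx.2.trans h1⟩
    rw [hd.deriv, abs_of_nonneg (mul_nonneg hsx.1 (by positivity))]
    calc s (w x) * ((1 - Real.tanh (k * (x - c) / ε) ^ 2) * (k * 1 / ε))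
        = k * s (w x) * (1 - Real.tanh (k * (x - c) / ε) ^ 2) / ε := by ring
      _ ≤ _ := by
        gcongr
        exact hwell _ hxI hsx.1 hsx.2
  have htanh : s (w z) - η * Real.exp (-(2 * k * ℓ) / ε)
      ≤ s (w z) * Real.tanh (k * (x₁ - x₀) / ε) := by
    have h1 := Real.one_sub_tanh_le (k * (x₁ - x₀) / ε)
    have h2 : Real.exp (-(2 * (k * (x₁ - x₀) / ε))) ≤ Real.exp (-(2 * k * ℓ) / ε) := by
      rw [Real.exp_le_exp, ← sub_nonneg]
      have : -(2 * k * ℓ) / ε - -(2 * (k * (x₁ - x₀) / ε)) = 2 * k * (x₁ - x₀ - ℓ) / ε := by ring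
      rw [this]
      exact div_nonneg (mul_nonneg (by positivity) (by linarith)) hε.le
    have h3 : s (w z) * (1 - Real.tanh (k * (x₁ - x₀) / ε))
        ≤ η / 2 * (2 * Real.exp (-(2 * k * ℓ) / ε)) :=
      mul_le_mul hsz (h1.trans (by linarith)) (by linarith [Real.tanh_lt_one (k * (x₁ - x₀) / ε)])
        (by positivity)
    linarith
  refine htanh.trans ?_
  rcases hz with rfl | rfl
  · have := key x₁
    rw [sub_self, mul_zero, zero_div, Real.tanh_zero, mul_zero, zero_sub, abs_neg,
      show k * (z - x₁) / ε = -(k * (x₁ - z) / ε) by ring, Real.tanh_neg, mul_neg, abs_neg] at this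
    exact (le_abs_self _).trans this
  · have := key x₀
    rw [sub_self, mul_zero, zero_div, Real.tanh_zero, mul_zero, sub_zero] at this
    exact (le_abs_self _).trans this

theorem abs_calib_sub_le (h : Admissible I α β D f) (hab : a < b)
    (hε : 0 < ε) (hw : MemH1 a b w) (hwI : ∀ x ∈ Icc a b, w x ∈ I)
    {x₀ x₁ : ℝ} (h0 : a ≤ x₀) (h1 : x₁ ≤ b) {x y : ℝ} (hx : x ∈ Icc x₀ x₁) (hy : y ∈ Icc x₀ x₁) :
    |calib D f α (w y) - calib D f α (w x)| ≤ ∫ x in x₀..x₁, density D f α a b ε w x :=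
  h.abs_sub_le_integral_density hab hε hw hwI h.contDiffOn_calib
    (fun _ hu => h.hasDerivAt_calib hu)
    (fun _ hu => (abs_of_nonneg (mul_nonneg (Real.sqrt_nonneg _) (h.D_pos hu).le)).le) h0 h1 hx hy

/-- The energy of one transition on an interval, when both end points of the interval have
distance at least `ℓ` from a point of the transition. -/
theorem gammaZero_sub_exp_le_integral_density (h : Admissible I α β D f) {η : ℝ} (hη : 0 < η)
    (hwell : ∀ u ∈ I,
      (0 ≤ calib D f α u → calib D f α u ≤ η →
        Real.sqrt (lam D f α β / 2) * calib D f α u ≤ potential D f α u) ∧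
      (0 ≤ gammaZero D f α β - calib D f α u → gammaZero D f α β - calib D f α u ≤ η →
        Real.sqrt (lam D f α β / 2) * (gammaZero D f α β - calib D f α u) ≤ potential D f α u))
    (hab : a < b) (hε : 0 < ε) (hw : MemH1 a b w) (hwI : ∀ x ∈ Icc a b, w x ∈ I)
    {x₀ x₁ y₀ y₁ ℓ : ℝ} (h0 : a ≤ x₀) (hℓ : 0 ≤ ℓ) (h0' : ℓ ≤ y₀ - x₀) (hy : y₀ ≤ y₁)
    (h1' : ℓ ≤ x₁ - y₁) (h1 : x₁ ≤ b)
    (hlayer : (calib D f α (w y₀) ≤ η / 2 ∧ gammaZero D f α β - calib D f α (w y₁) ≤ η / 2) ∨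
      (calib D f α (w y₁) ≤ η / 2 ∧ gammaZero D f α β - calib D f α (w y₀) ≤ η / 2)) :
    gammaZero D f α β - 2 * η * Real.exp (-(Real.sqrt (2 * lam D f α β) * ℓ) / ε)
      ≤ ∫ x in x₀..x₁, density D f α a b ε w x := by
  have hk : 0 < Real.sqrt (lam D f α β / 2) := Real.sqrt_pos.2 (half_pos h.lam_pos)
  have h2k : 2 * Real.sqrt (lam D f α β / 2) = Real.sqrt (2 * lam D f α β) := by
    rw [show 2 * lam D f α β = 2 ^ 2 * (lam D f α β / 2) by ring,
      Real.sqrt_mul (by positivity), Real.sqrt_sq (by positivity)]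
  have hint : ∀ x ∈ Icc a b, ∀ y ∈ Icc a b,
      IntervalIntegrable (density D f α a b ε w) volume x y := fun x hx y hy =>
    (h.intervalIntegrable_density hab.le hw hwI).mono_set (by
      rw [uIcc_of_le hab.le]; exact uIcc_subset_Icc hx hy)
  have hx₀ : x₀ ∈ Icc a b := ⟨h0, by linarith⟩
  have hx₁ : x₁ ∈ Icc a b := ⟨by linarith, h1⟩
  have hy₀ : y₀ ∈ Icc a b := ⟨by linarith, by linarith⟩
  have hy₁ : y₁ ∈ Icc a b := ⟨by linarith, by linarith⟩
  have hsplit : ∫ x in x₀..x₁, density D f α a b ε w x =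
      (∫ x in x₀..y₀, density D f α a b ε w x) + (∫ x in y₀..y₁, density D f α a b ε w x)
        + ∫ x in y₁..x₁, density D f α a b ε w x := by
    rw [intervalIntegral.integral_add_adjacent_intervals (hint _ hx₀ _ hy₀) (hint _ hy₀ _ hy₁),
      intervalIntegral.integral_add_adjacent_intervals (hint _ hx₀ _ hy₁) (hint _ hy₁ _ hx₁)]
  -- The middle piece pays `|F(w y₁) - F(w y₀)|`. The tail on the `α` side pays `F` at its inner
  -- end, the tail on the `β` side pays `γ₀ - F`, and the three contributions add up to `γ₀`.
  have hmid := h.abs_calib_sub_le hab hε hw hwI hy₀.1 hy₁.2 (left_mem_Icc.2 hy) (right_mem_Icc.2 hy)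
  have hF' : ∀ u ∈ I, |Real.sqrt (2 * potential D f α u) * D u| ≤
      Real.sqrt (2 * potential D f α u) * D u :=
    fun u hu => (abs_of_nonneg (mul_nonneg (Real.sqrt_nonneg _) (h.D_pos hu).le)).le
  have tailα := fun {x₀ x₁ z : ℝ} => h.sub_exp_le_integral_density hab hε hw hwI h.contDiffOn_calib
    (fun _ hu => h.hasDerivAt_calib hu) hF' hk hη (fun u hu => (hwell u hu).1)
    (x₀ := x₀) (x₁ := x₁) (z := z) (ℓ := ℓ)
  have tailβ := fun {x₀ x₁ z : ℝ} => h.sub_exp_le_integral_density hab hε hw hwI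
    (contDiffOn_const.sub h.contDiffOn_calib)
    (fun u hu => (h.hasDerivAt_calib hu).const_sub (gammaZero D f α β))
    (fun u hu => by rw [abs_neg]; exact hF' u hu) hk hη (fun u hu => (hwell u hu).2)
    (x₀ := x₀) (x₁ := x₁) (z := z) (ℓ := ℓ)
  rw [h2k] at tailα tailβ
  rw [hsplit]
  rcases hlayer with ⟨hl, hr⟩ | ⟨hr, hl⟩
  · have t0 := tailα h0 (by linarith) hy₀.2 h0' (Or.inr rfl) hl
    have t1 := tailβ hy₁.1 (by linarith) h1 h1' (Or.inl rfl) hr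
    linarith [le_abs_self (calib D f α (w y₁) - calib D f α (w y₀))]
  · have t0 := tailβ h0 (by linarith) hy₀.2 h0' (Or.inr rfl) hl
    have t1 := tailα hy₁.1 (by linarith) h1 h1' (Or.inl rfl) hr
    linarith [neg_abs_le (calib D f α (w y₁) - calib D f α (w y₀))]

end Admissible

end AllenCahn

/-! ### Step functions and the energy lower bound -/

theorem intervalIntegral.sum_integral_le_of_disjoint {ι : Type*} [Fintype ι] {a b : ℝ} {g : ℝ → ℝ}
    (hab : a ≤ b) (hg : IntervalIntegrable g volume a b) (hnn : ∀ x ∈ Icc a b, 0 ≤ g x)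
    {c d : ι → ℝ} (hcd : ∀ i, c i ≤ d i) (hc : ∀ i, a ≤ c i) (hd : ∀ i, d i ≤ b)
    (hdisj : ∀ i j, i ≠ j → d i ≤ c j ∨ d j ≤ c i) :
    ∑ i, ∫ x in (c i)..(d i), g x ≤ ∫ x in a..b, g x := by
  have hsub : ∀ i, Ioc (c i) (d i) ⊆ Ioc a b := fun i => Ioc_subset_Ioc (hc i) (hd i)
  have hgI : IntegrableOn g (Ioc a b) := (intervalIntegrable_iff_integrableOn_Ioc_of_le hab).1 hg
  have hU : ∑ i, ∫ x in (c i)..(d i), g x = ∫ x in ⋃ i ∈ Finset.univ, Ioc (c i) (d i), g x := by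
    rw [integral_biUnion_finset _ (fun i _ => measurableSet_Ioc) _
      fun i _ => hgI.mono_set (hsub i)]
    · exact Finset.sum_congr rfl fun i _ => intervalIntegral.integral_of_le (hcd i)
    · intro i _ j _ hij
      refine Set.disjoint_left.2 fun x hx hx' => ?_
      rcases hdisj i j hij with h | h
      · linarith [hx.2, hx'.1]
      · linarith [hx.1, hx'.2]
  rw [hU, intervalIntegral.integral_of_le hab]
  refine setIntegral_mono_set hgI ((ae_restrict_mem measurableSet_Ioc).mono fun x hx =>
    hnn x (Ioc_subset_Icc_self hx)) (LE.le.eventuallyLE ?_)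
  exact iUnion₂_subset fun i _ => hsub i

namespace AllenCahn

namespace IsStepFunction

variable {a b α β r : ℝ} {N : ℕ} {h : Fin N → ℝ} {v : ℝ → ℝ}

theorem le_abs_sub (hv : IsStepFunction a b α β N h r v) {i j : Fin N} (hij : i ≠ j) :
    2 * r < |h i - h j| := by
  rcases lt_or_gt_of_ne hij with hlt | hlt
  · rw [abs_sub_comm]
    linarith [hv.separated i j hlt, le_abs_self (h j - h i)]
  · linarith [hv.separated j i hlt, le_abs_self (h i - h j)]

theorem disjoint_intervals (hv : IsStepFunction a b α β N h r v) {ρ : ℝ} (hρ : ρ ≤ r)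
    {i j : Fin N} (hij : i ≠ j) : h i + ρ ≤ h j - ρ ∨ h j + ρ ≤ h i - ρ := by
  rcases lt_or_gt_of_ne hij with hlt | hlt
  · left; linarith [hv.separated i j hlt]
  · right; linarith [hv.separated j i hlt]

theorem exists_eq_of_between (hv : IsStepFunction a b α β N h r v) {c d : ℝ} (hcd : c < d)
    (hc : a ≤ c) (hd : d ≤ b) (hno : ∀ i, h i ∉ Ioo c d) :
    ∃ p, (p = α ∨ p = β) ∧ ∀ x ∈ Ioo c d, v x = p := by
  have hsub : Ioo c d ⊆ Icc a b := fun x hx => ⟨hc.trans hx.1.le, hx.2.le.trans hd⟩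
  have hm : (c + d) / 2 ∈ Ioo c d := ⟨by linarith, by linarith⟩
  refine ⟨v ((c + d) / 2), hv.mem_phases _ (hsub hm), fun x hx => ?_⟩
  have key : ∀ x ∈ Ioo c d, ∀ y ∈ Ioo c d, x < y → v x = v y := fun x hx y hy hxy =>
    hv.const_between x (hsub hx) y (hsub hy) hxy fun i hi =>
      hno i ⟨hx.1.trans_le hi.1, hi.2.trans_lt hy.2⟩
  rcases lt_trichotomy x ((c + d) / 2) with hlt | rfl | hlt
  · exact key _ hx _ hm hlt
  · rfl
  · exact (key _ hm _ hx hlt).symm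

theorem exists_sides (hv : IsStepFunction a b α β N h r v) (i : Fin N) :
    ∃ p q, (p = α ∧ q = β ∨ p = β ∧ q = α) ∧ (∀ x ∈ Ioo (h i - r) (h i), v x = p) ∧
      ∀ x ∈ Ioo (h i) (h i + r), v x = q := by
  have hr := hv.r_pos
  have hno : ∀ j, h j ∈ Ioo (h i - r) (h i + r) → j = i := fun j hj => by
    by_contra hne
    have : |h j - h i| < r := abs_lt.2 ⟨by linarith [hj.1], by linarith [hj.2]⟩
    linarith [hv.le_abs_sub hne]
  obtain ⟨p, hp, hp'⟩ := hv.exists_eq_of_between (c := h i - r) (d := h i) (by linarith)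
    (hv.left_le i) (by linarith [hv.le_right i]) fun j hj => by
      obtain rfl := hno j ⟨hj.1, by linarith [hj.2]⟩
      exact lt_irrefl _ hj.2
  obtain ⟨q, hq, hq'⟩ := hv.exists_eq_of_between (c := h i) (d := h i + r) (by linarith)
    (by linarith [hv.left_le i]) (hv.le_right i) fun j hj => by
      obtain rfl := hno j ⟨by linarith [hj.1], hj.2⟩
      exact lt_irrefl _ hj.1
  have hpq : p ≠ q := by
    have h1 : ∀ᶠ x in 𝓝[<] (h i), x ∈ Ioo (h i - r) (h i) := Ioo_mem_nhdsLT (by linarith)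
    have h2 : ∀ᶠ y in 𝓝[>] (h i), y ∈ Ioo (h i) (h i + r) := Ioo_mem_nhdsGT (by linarith)
    obtain ⟨x, hx, hjx⟩ := (h1.and (hv.jump i)).exists
    obtain ⟨y, hy, hjy⟩ := (h2.and hjx).exists
    rwa [hp' x hx, hq' y hy] at hjy
  refine ⟨p, q, ?_, hp', hq'⟩
  rcases hp with rfl | rfl <;> rcases hq with rfl | rfl <;> simp_all

/-- Off the finite set of jumps `v` is locally constant, hence continuous on an open set of full
measure. -/
theorem aestronglyMeasurable (hv : IsStepFunction a b α β N h r v) :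
    AEStronglyMeasurable v (volume.restrict (Icc a b)) := by
  have hopen : IsOpen (Ioo a b \ range h) := isOpen_Ioo.sdiff (finite_range h).isClosed
  have hcont : ContinuousOn v (Ioo a b \ range h) := by
    intro x hx
    refine ContinuousAt.continuousWithinAt ?_
    obtain ⟨ρ, hρ, hball⟩ := Metric.isOpen_iff.1 hopen x hx
    rw [Real.ball_eq_Ioo] at hball
    have hsub : Icc (x - ρ / 2) (x + ρ / 2) ⊆ Ioo a b \ range h := fun y hy =>
      hball ⟨by linarith [hy.1], by linarith [hy.2]⟩
    obtain ⟨p, -, hp⟩ := hv.exists_eq_of_between (c := x - ρ / 2) (d := x + ρ / 2) (by linarith)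
      (hsub (left_mem_Icc.2 (by linarith))).1.1.le (hsub (right_mem_Icc.2 (by linarith))).1.2.le
      fun i hi => (hsub (Ioo_subset_Icc_self hi)).2 ⟨i, rfl⟩
    have hev : v =ᶠ[𝓝 x] fun _ => p :=
      eventually_of_mem (Ioo_mem_nhds (a := x - ρ / 2) (b := x + ρ / 2) (by linarith)
        (by linarith)) hp
    exact continuousAt_const.congr hev.symm
  have hae : (Ioo a b \ range h : Set ℝ) =ᵐ[volume] Icc a b :=
    (sdiff_null_ae_eq_self ((finite_range h).measure_zero _)).trans Ioo_ae_eq_Icc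
  rw [← Measure.restrict_congr_set hae]
  exact hcont.aestronglyMeasurable hopen.measurableSet

theorem intervalIntegrable (hv : IsStepFunction a b α β N h r v) (hab : a ≤ b) :
    IntervalIntegrable v volume a b := by
  rw [intervalIntegrable_iff_integrableOn_Icc_of_le hab]
  refine Integrable.of_bound hv.aestronglyMeasurable (max |α| |β|)
    ((ae_restrict_mem measurableSet_Icc).mono fun x hx => ?_)
  rcases hv.mem_phases x hx with h | h <;> simp [h]

theorem intervalIntegrable_abs_sub (hv : IsStepFunction a b α β N h r v) (hab : a ≤ b) {w : ℝ → ℝ}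
    (hw : ContinuousOn w (Icc a b)) : IntervalIntegrable (fun x => |w x - v x|) volume a b :=
  ((hw.intervalIntegrable_of_Icc hab).sub (hv.intervalIntegrable hab)).abs

/-- The mean of `|w - v|` over `(c, d)` is at most `σ`, so it cannot exceed `σ` everywhere. This is
how `L¹` closeness supplies points with `w` near a phase. -/
theorem exists_abs_sub_le (hv : IsStepFunction a b α β N h r v) (hab : a ≤ b) {w : ℝ → ℝ}
    (hw : ContinuousOn w (Icc a b)) {c d σ : ℝ} (hcd : c < d) (hc : a ≤ c) (hd : d ≤ b)
    (hle : ∫ x in a..b, |w x - v x| ≤ σ * (d - c)) : ∃ x ∈ Ioo c d, |w x - v x| ≤ σ := by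
  by_contra! hcon
  have hint := hv.intervalIntegrable_abs_sub hab hw
  have hint' : IntervalIntegrable (fun x => |w x - v x|) volume c d := hint.mono_set (by
    rw [uIcc_of_le hab, uIcc_of_le hcd.le]; exact Icc_subset_Icc hc hd)
  have hpos := intervalIntegral.intervalIntegral_pos_of_pos_on
    (hint'.sub (intervalIntegrable_const (c := σ))) (fun x hx => sub_pos.2 (hcon x hx)) hcd
  rw [intervalIntegral.integral_sub hint' intervalIntegrable_const, intervalIntegral.integral_const,
    smul_eq_mul] at hpos
  have hmono : ∫ x in c..d, |w x - v x| ≤ ∫ x in a..b, |w x - v x| :=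
    intervalIntegral.integral_mono_interval hc hcd.le hd (ae_of_all _ fun x => abs_nonneg _) hint
  linarith

theorem exists_layer_points (hv : IsStepFunction a b α β N h r v) (hab : a ≤ b) {w : ℝ → ℝ}
    (hw : ContinuousOn w (Icc a b)) {ρ σ : ℝ} (hρ : 0 < ρ) (hρr : ρ ≤ r)
    (hle : ∫ x in a..b, |w x - v x| ≤ σ * ρ) (i : Fin N) :
    ∃ x ∈ Ioo (h i - ρ) (h i), ∃ y ∈ Ioo (h i) (h i + ρ),
      (|w x - α| ≤ σ ∧ |w y - β| ≤ σ) ∨ (|w y - α| ≤ σ ∧ |w x - β| ≤ σ) := by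
  obtain ⟨p, q, hpq, hp, hq⟩ := hv.exists_sides i
  obtain ⟨x, hx, hwx⟩ := hv.exists_abs_sub_le hab hw (c := h i - ρ) (d := h i) (σ := σ)
    (by linarith) (by linarith [hv.left_le i]) (by linarith [hv.le_right i]) (by simpa using hle)
  obtain ⟨y, hy, hwy⟩ := hv.exists_abs_sub_le hab hw (c := h i) (d := h i + ρ) (σ := σ)
    (by linarith) (by linarith [hv.left_le i]) (by linarith [hv.le_right i]) (by simpa using hle)
  rw [hp x ⟨by linarith [hx.1], hx.2⟩] at hwx
  rw [hq y ⟨hy.1, by linarith [hy.2]⟩] at hwy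
  refine ⟨x, hx, y, hy, ?_⟩
  rcases hpq with ⟨rfl, rfl⟩ | ⟨rfl, rfl⟩
  · exact Or.inl ⟨hwx, hwy⟩
  · exact Or.inr ⟨hwy, hwx⟩

end IsStepFunction

namespace Admissible

variable {I : Set ℝ} {α β : ℝ} {D f : ℝ → ℝ} {a b r : ℝ} {N : ℕ} {h : Fin N → ℝ} {v : ℝ → ℝ}

theorem exists_abs_calib_le (hDf : Admissible I α β D f) {θ : ℝ} (hθ : 0 < θ) :
    ∃ σ > 0, ∀ u, (|u - α| ≤ σ → |calib D f α u| ≤ θ) ∧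
      (|u - β| ≤ σ → |calib D f α u - gammaZero D f α β| ≤ θ) := by
  obtain ⟨σ₁, hσ₁, h1⟩ := hDf.exists_abs_calib_sub_le hDf.left_mem hθ
  obtain ⟨σ₂, hσ₂, h2⟩ := hDf.exists_abs_calib_sub_le hDf.right_mem hθ
  refine ⟨min σ₁ σ₂, lt_min hσ₁ hσ₂, fun u => ⟨fun hu => ?_, fun hu => ?_⟩⟩
  · simpa using h1 u (hu.trans (min_le_left _ _))
  · exact h2 u (hu.trans (min_le_right _ _))

/-- A function close to the step function has energy at least `N γ₀`, up to an exponentially small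
error. -/
theorem exists_energy_lower_bound (hDf : Admissible I α β D f) (hab : a < b)
    (hv : IsStepFunction a b α β N h r v) {A : ℝ}
    (hA : A ∈ Ioo 0 (r * Real.sqrt (2 * lam D f α β))) :
    ∃ δ > 0, ∃ C > 0, ∀ ε > 0, ∀ w, MemH1 a b w → (∀ x ∈ Icc a b, w x ∈ I) →
      ∫ x in a..b, |w x - v x| ≤ δ →
      N * gammaZero D f α β - C * Real.exp (-A / ε) ≤ energy D f α a b ε w := by
  obtain ⟨η, hη, hwell⟩ := hDf.exists_well_estimate
  obtain ⟨σ, hσ, hcal⟩ := hDf.exists_abs_calib_le (half_pos hη)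
  have hsqrt : 0 < Real.sqrt (2 * lam D f α β) := Real.sqrt_pos.2 (mul_pos two_pos hDf.lam_pos)
  -- The layer points lie within `ρ` of the jump, leaving tails of length at least `r - ρ`; this `ρ`
  -- makes the decay rate `√(2λ) (r - ρ)` equal to `A`.
  set ρ := r - A / Real.sqrt (2 * lam D f α β) with hρdef
  have hAρ : Real.sqrt (2 * lam D f α β) * (r - ρ) = A := by
    rw [hρdef]; field_simp; ring
  have hρ : 0 < ρ := by
    rw [hρdef, sub_pos, div_lt_iff₀ hsqrt]; exact hA.2
  have hρr : ρ < r := by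
    have : 0 < A / Real.sqrt (2 * lam D f α β) := div_pos hA.1 hsqrt
    linarith
  refine ⟨σ * ρ, by positivity, 2 * η * N + 1, by positivity, fun ε hε w hw hwI hL1 => ?_⟩
  have hlayer : ∀ i, gammaZero D f α β - 2 * η * Real.exp (-A / ε) ≤
      ∫ x in (h i - r)..(h i + r), density D f α a b ε w x := fun i => by
    obtain ⟨x, hx, y, hy, hxy⟩ :=
      hv.exists_layer_points hab.le (hw.continuousOn hab.le) hρ hρr.le hL1 i
    have := hDf.gammaZero_sub_exp_le_integral_density hη hwell hab hε hw hwI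
      (x₀ := h i - r) (x₁ := h i + r) (y₀ := x) (y₁ := y) (ℓ := r - ρ) (hv.left_le i)
      (by linarith) (by linarith [hx.1]) (by linarith [hx.2, hy.1]) (by linarith [hy.2])
      (hv.le_right i) ?_
    · rwa [hAρ] at this
    · rcases hxy with ⟨h1, h2⟩ | ⟨h1, h2⟩
      · exact Or.inl ⟨(le_abs_self _).trans ((hcal _).1 h1),
          by linarith [(abs_le.1 ((hcal _).2 h2)).1]⟩
      · exact Or.inr ⟨(le_abs_self _).trans ((hcal _).1 h1),
          by linarith [(abs_le.1 ((hcal _).2 h2)).1]⟩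
  have hsum := intervalIntegral.sum_integral_le_of_disjoint hab.le
    (hDf.intervalIntegrable_density (ε := ε) hab.le hw hwI)
    (fun x hx => hDf.density_nonneg hε hwI hx) (c := fun i => h i - r) (d := fun i => h i + r)
    (fun i => by linarith [hv.r_pos]) hv.left_le hv.le_right
    (fun i j hij => hv.disjoint_intervals le_rfl hij)
  have hcard := (Finset.sum_le_sum fun i (_ : i ∈ Finset.univ) => hlayer i).trans hsum
  rw [Finset.sum_const, Finset.card_univ, Fintype.card_fin, nsmul_eq_mul,
    ← energy_eq_integral_density] at hcard
  nlinarith [Real.exp_pos (-A / ε)]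

/-- The variation of `F(w)` through an intermediate point. It charges for an overshoot on top of the
transition itself. -/
theorem three_point_estimate (hDf : Admissible I α β D f) (hab : a < b) {ε : ℝ} (hε : 0 < ε)
    {w : ℝ → ℝ} (hw : MemH1 a b w) (hwI : ∀ x ∈ Icc a b, w x ∈ I)
    {x₀ x₁ : ℝ} (h0 : a ≤ x₀) (h1 : x₁ ≤ b) {x y z : ℝ} (hx : x₀ ≤ x) (hxy : x ≤ y) (hyz : y ≤ z)
    (hz : z ≤ x₁) :
    |calib D f α (w y) - calib D f α (w x)| + |calib D f α (w z) - calib D f α (w y)|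
      ≤ ∫ x in x₀..x₁, density D f α a b ε w x := by
  have hint : ∀ x ∈ Icc a b, ∀ y ∈ Icc a b,
      IntervalIntegrable (density D f α a b ε w) volume x y := fun x hx y hy =>
    (hDf.intervalIntegrable_density hab.le hw hwI).mono_set (by
      rw [uIcc_of_le hab.le]; exact uIcc_subset_Icc hx hy)
  have ha : a ≤ x := h0.trans hx
  have hb : z ≤ b := hz.trans h1
  have e1 := hDf.abs_calib_sub_le hab hε hw hwI ha (hyz.trans hb) (left_mem_Icc.2 hxy)
    (right_mem_Icc.2 hxy)
  have e2 := hDf.abs_calib_sub_le hab hε hw hwI (ha.trans hxy) hb (left_mem_Icc.2 hyz)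
    (right_mem_Icc.2 hyz)
  have e3 := hDf.integral_density_mono hε hab.le hw hwI h0 hx (hxy.trans hyz) hz h1
  rw [← intervalIntegral.integral_add_adjacent_intervals
    (hint x ⟨ha, by linarith⟩ y ⟨by linarith, by linarith⟩)
    (hint y ⟨by linarith, by linarith⟩ z ⟨by linarith, hb⟩)] at e3
  linarith

end Admissible

/-! ### Localization of functions with nearly minimal energy -/

namespace Admissible

variable {I : Set ℝ} {α β : ℝ} {D f : ℝ → ℝ} {a b r : ℝ} {N : ℕ} {h : Fin N → ℝ} {v : ℝ → ℝ}

/-- If `w` is close to the step function and its energy does not exceed `N γ₀` by much, then `w`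
nowhere leaves a neighbourhood of `[α, β]`, and it is close to the phases away from the jumps. -/
theorem exists_localization (hDf : Admissible I α β D f) (hab : a < b) (hN : 1 ≤ N)
    (hv : IsStepFunction a b α β N h r v) {δ κ : ℝ} (hδ : δ ∈ Ioo 0 r) (hκ : 0 < κ) :
    ∃ σ > 0, ∀ ε > 0, ∀ w, MemH1 a b w → (∀ x ∈ Icc a b, w x ∈ I) →
      ∫ x in a..b, |w x - v x| ≤ σ →
      energy D f α a b ε w ≤ N * gammaZero D f α β + σ → ∀ x ∈ Icc a b,
        (-κ < calib D f α (w x) ∧ calib D f α (w x) < gammaZero D f α β + κ) ∧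
        ((∀ i, δ ≤ |x - h i|) →
          |calib D f α (w x)| < κ ∨ |calib D f α (w x) - gammaZero D f α β| < κ) := by
  have hγ := hDf.gammaZero_pos
  -- The budget: the errors at the layer points total at most `(2 N + 1) θ < κ / 2`, and the
  -- admitted energy excess is at most `κ / 4`, so less than `κ` in all.
  set θ := κ / (4 * N + 4) with hθdef
  have hθ : 0 < θ := by positivity
  have hθκ : (4 * N + 4) * θ = κ := by rw [hθdef]; field_simp
  obtain ⟨σ, hσ, hcal⟩ := hDf.exists_abs_calib_le hθ
  have hρ : 0 < δ / 2 := half_pos hδ.1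
  refine ⟨min (κ / 4) (σ * (δ / 2)), by positivity, fun ε hε w hw hwI hL1 hE x hx => ?_⟩
  replace hL1 := hL1.trans (min_le_right _ _)
  replace hE := hE.trans (add_le_add_right (min_le_left _ _) _)
  have hwc := hw.continuousOn hab.le
  have hNθ : 0 ≤ N * θ := by positivity
  have hpts := hv.exists_layer_points hab.le hwc hρ (by linarith [hδ.2]) hL1
  have hlayer : ∀ i, ∀ ρ, δ / 2 ≤ ρ → ρ ≤ r → gammaZero D f α β - 2 * θ ≤
      ∫ x in (h i - ρ)..(h i + ρ), density D f α a b ε w x := fun i ρ h1 h2 => by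
    obtain ⟨y, hy, z, hz, hyz⟩ := hpts i
    have := hDf.abs_calib_sub_le hab hε hw hwI (x₀ := h i - ρ) (x₁ := h i + ρ)
      (by linarith [hv.left_le i]) (by linarith [hv.le_right i])
      (x := y) (y := z) ⟨by linarith [hy.1], by linarith [hy.2]⟩
      ⟨by linarith [hz.1], by linarith [hz.2]⟩
    rcases hyz with ⟨h1, h2⟩ | ⟨h1, h2⟩
    · have h1 := abs_le.1 ((hcal _).1 h1)
      have h2 := abs_le.1 ((hcal _).2 h2)
      linarith [le_abs_self (calib D f α (w z) - calib D f α (w y))]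
    · have h1 := abs_le.1 ((hcal _).1 h1)
      have h2 := abs_le.1 ((hcal _).2 h2)
      linarith [neg_abs_le (calib D f α (w z) - calib D f α (w y))]
  by_cases hfar : ∀ i, δ ≤ |x - h i|
  -- A window of length `δ / 2` with `x` at one end, placed to the right of `x` if it fits in `[a,
  -- b]` and to the left otherwise. It overlaps none of the `δ / 2`-neighbourhoods of the jumps;
  -- these take nearly all the energy, so `F(w)` hardly varies in the window.
  · obtain ⟨c, hca, hcb, hcx, hxc⟩ : ∃ c, a ≤ c ∧ c + δ / 2 ≤ b ∧ c ≤ x ∧ x ≤ c + δ / 2 := by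
      by_cases hxb : x + δ / 2 ≤ b
      · exact ⟨x, hx.1, hxb, le_rfl, by linarith⟩
      · have := hv.left_le ⟨0, hN⟩
        have := hv.le_right ⟨0, hN⟩
        exact ⟨x - δ / 2, by linarith [hδ.2], by linarith [hx.2], by linarith, by linarith⟩
    obtain ⟨y, hy, hwy⟩ := hv.exists_abs_sub_le hab.le hwc (c := c) (d := c + δ / 2) (σ := σ)
      (by linarith) hca hcb (by simpa using hL1)
    have hxy := hDf.abs_calib_sub_le hab hε hw hwI hca hcb (x := y) (y := x)
      (Ioo_subset_Icc_self hy) ⟨hcx, hxc⟩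
    -- The index `none` stands for the window, `some i` for the layers.
    have hsum := intervalIntegral.sum_integral_le_of_disjoint (ι := Option (Fin N)) hab.le
      (hDf.intervalIntegrable_density (ε := ε) hab.le hw hwI)
      (fun x hx => hDf.density_nonneg hε hwI hx)
      (c := fun o => o.elim c fun i => h i - δ / 2)
      (d := fun o => o.elim (c + δ / 2) fun i => h i + δ / 2) ?_ ?_ ?_ ?_
    rotate_left
    · rintro (_ | i) <;> simp only [Option.elim] <;> linarith
    · rintro (_ | i) <;> simp only [Option.elim]
      · exact hca
      · linarith [hv.left_le i, hδ.1, hδ.2]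
    · rintro (_ | i) <;> simp only [Option.elim]
      · exact hcb
      · linarith [hv.le_right i, hδ.1, hδ.2]
    · have hJ : ∀ i, c + δ / 2 ≤ h i - δ / 2 ∨ h i + δ / 2 ≤ c := fun i => by
        rcases le_abs.1 (hfar i) with h1 | h1
        · right; linarith
        · left; linarith
      rintro (_ | i) (_ | j) hij <;> simp only [Option.elim]
      · exact absurd rfl hij
      · exact hJ j
      · exact (hJ i).symm
      · exact hv.disjoint_intervals (by linarith [hδ.1, hδ.2]) fun h => hij (by rw [h])
    rw [Fintype.sum_option] at hsum
    simp only [Option.elim] at hsum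
    have hcard := Finset.sum_le_sum fun i (_ : i ∈ Finset.univ) =>
      hlayer i (δ / 2) le_rfl (by linarith [hδ.1, hδ.2])
    rw [Finset.sum_const, Finset.card_univ, Fintype.card_fin, nsmul_eq_mul] at hcard
    rw [← energy_eq_integral_density] at hsum
    have hdiff := abs_le.1 (show |calib D f α (w x) - calib D f α (w y)| ≤ 2 * (N * θ) + κ / 4 by
      linarith)
    rcases hv.mem_phases y ⟨by linarith [hy.1], by linarith [hy.2]⟩ with hvy | hvy <;>
      rw [hvy] at hwy
    · have hc := abs_le.1 ((hcal _).1 hwy)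
      have : |calib D f α (w x)| < κ := abs_lt.2 ⟨by linarith, by linarith⟩
      exact ⟨⟨by linarith, by linarith⟩, fun _ => Or.inl this⟩
    · have hc := abs_le.1 ((hcal _).2 hwy)
      have : |calib D f α (w x) - gammaZero D f α β| < κ := abs_lt.2 ⟨by linarith, by linarith⟩
      exact ⟨⟨by linarith, by linarith⟩, fun _ => Or.inr this⟩
  · refine ⟨?_, fun hfar' => absurd hfar' hfar⟩
    push Not at hfar
    obtain ⟨i, hi⟩ := hfar
    have hi := abs_lt.1 hi
    by_contra hout
    have hsum := intervalIntegral.sum_integral_le_of_disjoint hab.le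
      (hDf.intervalIntegrable_density (ε := ε) hab.le hw hwI)
      (fun x hx => hDf.density_nonneg hε hwI hx) (c := fun i => h i - δ) (d := fun i => h i + δ)
      (fun i => by linarith [hδ.1]) (fun i => by linarith [hv.left_le i, hδ.2])
      (fun i => by linarith [hv.le_right i, hδ.2])
      (fun i j hij => hv.disjoint_intervals hδ.2.le hij)
    -- Near a jump, an excursion of `F(w)` by `κ` outside `[0, γ₀]` costs at least `κ - θ` beyond
    -- the transition, whatever the order of `x` and the two layer points.
    have hbad : gammaZero D f α β + κ - 3 * θ ≤
        ∫ x in (h i - δ)..(h i + δ), density D f α a b ε w x := by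
      obtain ⟨y, hy, z, hz, hyz⟩ := hpts i
      have three := fun {p q s : ℝ} => hDf.three_point_estimate hab hε hw hwI
        (x₀ := h i - δ) (x₁ := h i + δ) (by linarith [hv.left_le i, hδ.2])
        (by linarith [hv.le_right i, hδ.2]) (x := p) (y := q) (z := s)
      have hout' : calib D f α (w x) ≤ -κ ∨ gammaZero D f α β + κ ≤ calib D f α (w x) := by
        by_contra! hcon
        exact hout hcon
      have hwell : (|calib D f α (w y)| ≤ θ ∧ |calib D f α (w z) - gammaZero D f α β| ≤ θ) ∨
          (|calib D f α (w z)| ≤ θ ∧ |calib D f α (w y) - gammaZero D f α β| ≤ θ) :=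
        hyz.imp (fun h => ⟨(hcal _).1 h.1, (hcal _).2 h.2⟩)
          fun h => ⟨(hcal _).1 h.1, (hcal _).2 h.2⟩
      have hκθ : θ ≤ κ := by linarith
      simp only [abs_le] at hwell
      rcases le_total x y with hxy | hxy
      · have t := three (by linarith) hxy (by linarith [hy.2, hz.1] : y ≤ z) (by linarith [hz.2])
        rcases hwell with h | h <;> rcases hout' with h' | h' <;>
          linarith [le_abs_self (calib D f α (w y) - calib D f α (w x)),
            neg_abs_le (calib D f α (w y) - calib D f α (w x)),
            le_abs_self (calib D f α (w z) - calib D f α (w y)),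
            neg_abs_le (calib D f α (w z) - calib D f α (w y))]
      rcases le_total x z with hxz | hxz
      · have t := three (by linarith [hy.1]) hxy hxz (by linarith [hz.2])
        rcases hwell with h | h <;> rcases hout' with h' | h' <;>
          linarith [le_abs_self (calib D f α (w x) - calib D f α (w y)),
            neg_abs_le (calib D f α (w x) - calib D f α (w y)),
            le_abs_self (calib D f α (w z) - calib D f α (w x)),
            neg_abs_le (calib D f α (w z) - calib D f α (w x))]
      · have t := three (by linarith [hy.1]) (by linarith [hy.2, hz.1] : y ≤ z) hxz (by linarith)
        rcases hwell with h | h <;> rcases hout' with h' | h' <;>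
          linarith [le_abs_self (calib D f α (w z) - calib D f α (w y)),
            neg_abs_le (calib D f α (w z) - calib D f α (w y)),
            le_abs_self (calib D f α (w x) - calib D f α (w z)),
            neg_abs_le (calib D f α (w x) - calib D f α (w z))]
    have hcard : ∑ j, ((gammaZero D f α β - 2 * θ) + if j = i then κ - θ else 0) ≤
        ∑ j, ∫ x in (h j - δ)..(h j + δ), density D f α a b ε w x := by
      refine Finset.sum_le_sum fun j _ => ?_
      split_ifs with hji
      · rw [hji]; linarith
      · rw [add_zero]
        exact hlayer j δ (by linarith [hδ.1]) hδ.2.le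
    rw [Finset.sum_add_distrib, Finset.sum_const, Finset.card_univ, Fintype.card_fin, nsmul_eq_mul,
      Finset.sum_ite_eq' Finset.univ i, if_pos (Finset.mem_univ _)] at hcard
    rw [← energy_eq_integral_density] at hsum
    linarith

end Admissible

end AllenCahn

/-! ### Monotonicity from one-sided slopes -/

/-- The reflection `τ ↦ s + t - τ` turns left slopes into right slopes, for which the mean value
inequality with lower right derivatives is available. -/
theorem le_of_left_slope_le {Θ : ℝ → ℝ} {s t : ℝ} (hst : s ≤ t) (hcont : ContinuousOn Θ (Icc s t))
    (hslope : ∀ σ ∈ Ioc s t, ∀ η > 0, ∀ᶠ z in 𝓝[<] σ, (Θ σ - Θ z) / (σ - z) ≤ η) :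
    Θ t ≤ Θ s := by
  have hmaps : MapsTo (fun τ => s + t - τ) (Icc s t) (Icc s t) := fun τ hτ =>
    ⟨by linarith [hτ.2], by linarith [hτ.1]⟩
  have hc : ContinuousOn (fun τ => -Θ (s + t - τ)) (Icc s t) :=
    (hcont.comp (by fun_prop) hmaps).neg
  have := image_le_of_liminf_slope_right_le_deriv_boundary hc (B := fun _ => -Θ t)
    (B' := fun _ => 0) (by simp) continuousOn_const (fun x _ => hasDerivWithinAt_const _ _ _)
    (fun τ hτ η hη => ?_) (right_mem_Icc.2 hst)
  · simpa using this
  · have hev := hslope (s + t - τ) ⟨by linarith [hτ.2], by linarith [hτ.1]⟩ (η / 2) (half_pos hη)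
    have htend : Tendsto (fun z => s + t - z) (𝓝[>] τ) (𝓝[<] (s + t - τ)) :=
      tendsto_nhdsWithin_iff.2 ⟨((continuous_const.sub continuous_id).tendsto τ).mono_left
        nhdsWithin_le_nhds, (eventually_mem_nhdsWithin).mono fun z hz => by
          simp only [mem_Ioi] at hz
          simp only [mem_Iio]; linarith⟩
    refine ((htend.eventually hev).mono fun z hz => ?_).frequently
    rw [slope_def_field, show (-Θ (s + t - z) - -Θ (s + t - τ)) / (z - τ)
      = (Θ (s + t - τ) - Θ (s + t - z)) / (s + t - τ - (s + t - z)) by congr 1 <;> ring]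
    linarith

/-! ### Convergence in `L²` and the embedding of `H¹` -/

namespace AllenCahn

section L2
variable {a b : ℝ}

theorem intervalIntegral_eq_restrict_Icc (hab : a ≤ b) (g : ℝ → ℝ) :
    ∫ x in a..b, g x = ∫ x, g x ∂volume.restrict (Icc a b) := by
  rw [intervalIntegral.integral_of_le hab, integral_Icc_eq_integral_Ioc]

theorem _root_.MeasureTheory.MemLp.intervalIntegrable_mul (hab : a ≤ b) {g k : ℝ → ℝ}
    (hg : MemLp g 2 (volume.restrict (Icc a b))) (hk : MemLp k 2 (volume.restrict (Icc a b))) :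
    IntervalIntegrable (fun x => g x * k x) volume a b :=
  (intervalIntegrable_iff_restrict_Icc hab).2 (hg.integrable_mul hk)

theorem _root_.MeasureTheory.MemLp.intervalIntegrable_sq (hab : a ≤ b) {g : ℝ → ℝ}
    (hg : MemLp g 2 (volume.restrict (Icc a b))) :
    IntervalIntegrable (fun x => g x ^ 2) volume a b :=
  (intervalIntegrable_iff_restrict_Icc hab).2 hg.integrable_sq

theorem _root_.ContinuousOn.memLp_Icc {p : ENNReal} {g : ℝ → ℝ} (hg : ContinuousOn g (Icc a b)) :
    MemLp g p (volume.restrict (Icc a b)) := by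
  obtain ⟨C, hC⟩ := isCompact_Icc.exists_bound_of_continuousOn hg
  exact MemLp.of_bound (hg.aestronglyMeasurable measurableSet_Icc) C
    ((ae_restrict_mem measurableSet_Icc).mono hC)

theorem integral_abs_mul_le (hab : a ≤ b) {g k : ℝ → ℝ}
    (hg : MemLp g 2 (volume.restrict (Icc a b))) (hk : MemLp k 2 (volume.restrict (Icc a b))) :
    ∫ x in a..b, |g x * k x| ≤
      Real.sqrt (∫ x in a..b, g x ^ 2) * Real.sqrt (∫ x in a..b, k x ^ 2) := by
  have := integral_mul_norm_le_Lp_mul_Lq (μ := volume.restrict (Icc a b)) (f := g) (g := k)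
    (p := 2) (q := 2) (by rw [Real.holderConjugate_iff]; norm_num) (by simpa using hg)
    (by simpa using hk)
  rw [Real.sqrt_eq_rpow, Real.sqrt_eq_rpow]
  simp only [intervalIntegral_eq_restrict_Icc hab]
  simpa [abs_mul] using this

theorem abs_integral_mul_le (hab : a ≤ b) {g k : ℝ → ℝ}
    (hg : MemLp g 2 (volume.restrict (Icc a b))) (hk : MemLp k 2 (volume.restrict (Icc a b))) :
    |∫ x in a..b, g x * k x| ≤
      Real.sqrt (∫ x in a..b, g x ^ 2) * Real.sqrt (∫ x in a..b, k x ^ 2) :=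
  (intervalIntegral.abs_integral_le_integral_abs hab).trans (integral_abs_mul_le hab hg hk)

theorem l2DistSq_nonneg (hab : a ≤ b) (w z : ℝ → ℝ) : 0 ≤ l2DistSq a b w z :=
  intervalIntegral.integral_nonneg hab fun _ _ => sq_nonneg _

theorem tendsto_integral_mul {ι : Type*} {l : Filter ι} (hab : a ≤ b) {F : ι → ℝ → ℝ}
    {F₀ g : ℝ → ℝ} (hF : ∀ᶠ t in l, MemLp (F t) 2 (volume.restrict (Icc a b)))
    (hF₀ : MemLp F₀ 2 (volume.restrict (Icc a b))) (hg : MemLp g 2 (volume.restrict (Icc a b)))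
    (h : Tendsto (fun t => l2DistSq a b (F t) F₀) l (𝓝 0)) :
    Tendsto (fun t => ∫ x in a..b, F t x * g x) l (𝓝 (∫ x in a..b, F₀ x * g x)) := by
  rw [tendsto_iff_dist_tendsto_zero]
  have hlim : Tendsto (fun t => Real.sqrt (l2DistSq a b (F t) F₀) *
      Real.sqrt (∫ x in a..b, g x ^ 2)) l (𝓝 0) := by
    simpa using (h.sqrt).mul_const (Real.sqrt (∫ x in a..b, g x ^ 2))
  refine squeeze_zero' (Eventually.of_forall fun _ => dist_nonneg) (hF.mono fun t ht => ?_) hlim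
  rw [Real.dist_eq, ← intervalIntegral.integral_sub (ht.intervalIntegrable_mul hab hg)
    (hF₀.intervalIntegrable_mul hab hg)]
  simp only [← sub_mul]
  exact abs_integral_mul_le hab (ht.sub hF₀) hg

theorem tendsto_integral_sq {ι : Type*} {l : Filter ι} (hab : a ≤ b) {F : ι → ℝ → ℝ}
    {F₀ : ℝ → ℝ} (hF : ∀ᶠ t in l, MemLp (F t) 2 (volume.restrict (Icc a b)))
    (hF₀ : MemLp F₀ 2 (volume.restrict (Icc a b)))
    (h : Tendsto (fun t => l2DistSq a b (F t) F₀) l (𝓝 0)) :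
    Tendsto (fun t => ∫ x in a..b, F t x ^ 2) l (𝓝 (∫ x in a..b, F₀ x ^ 2)) := by
  have h2 := (h.add ((tendsto_integral_mul hab hF hF₀ hF₀ h).const_mul 2)).sub_const
    (∫ x in a..b, F₀ x ^ 2)
  have hval : 0 + 2 * (∫ x in a..b, F₀ x * F₀ x) - ∫ x in a..b, F₀ x ^ 2
      = ∫ x in a..b, F₀ x ^ 2 := by
    simp only [← sq]; ring
  rw [hval] at h2
  refine h2.congr' (hF.mono fun t ht => ?_)
  beta_reduce
  have hi1 : IntervalIntegrable (fun x => (F t x - F₀ x) ^ 2) volume a b :=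
    (ht.sub hF₀).intervalIntegrable_sq hab
  have hi2 := ht.intervalIntegrable_mul hab hF₀
  have hi3 := hF₀.intervalIntegrable_sq hab
  have : ∫ x in a..b, F t x ^ 2 = ∫ x in a..b,
      ((F t x - F₀ x) ^ 2 + 2 * (F t x * F₀ x) - F₀ x ^ 2) :=
    intervalIntegral.integral_congr fun x _ => by ring
  rw [this, intervalIntegral.integral_sub (hi1.add (hi2.const_mul 2)) hi3,
    intervalIntegral.integral_add hi1 (hi2.const_mul 2), intervalIntegral.integral_const_mul]
  rfl

/-- The embedding of `H¹` into the bounded functions. -/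
theorem MemH1.sq_sub_le (hab : a < b) {w z : ℝ → ℝ} (hw : MemH1 a b w) (hz : MemH1 a b z)
    {x : ℝ} (hx : x ∈ Icc a b) :
    (w x - z x) ^ 2 ≤ (2 / (b - a) + 2 * (b - a)) * h1DistSq a b w z := by
  set g := fun x => w x - z x with hg
  have hgac : AbsolutelyContinuousOnInterval g a b :=
    hw.absolutelyContinuous.fun_sub hz.absolutelyContinuous
  have hder : deriv g =ᵐ[volume.restrict (Icc a b)] fun x => dx a b w x - dx a b z x := by
    rw [← Measure.restrict_congr_set (Ioo_ae_eq_Icc (μ := volume) (a := a) (b := b))]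
    filter_upwards [ae_restrict_mem measurableSet_Ioo,
      ae_restrict_of_ae hw.absolutelyContinuous.ae_differentiableAt,
      ae_restrict_of_ae hz.absolutelyContinuous.ae_differentiableAt] with y hy h1 h2
    have hy' : y ∈ uIcc a b := by rw [uIcc_of_le hab.le]; exact Ioo_subset_Icc_self hy
    rw [dx_eq_deriv hy, dx_eq_deriv hy]
    exact deriv_fun_sub (h1 hy') (h2 hy')
  have hL2 : MemLp (deriv g) 2 (volume.restrict (Icc a b)) :=
    (hw.memLp_dx.sub hz.memLp_dx).ae_eq hder.symm
  set E := ∫ x in a..b, deriv g x ^ 2 with hE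
  have hE' : E = l2DistSq a b (dx a b w) (dx a b z) := by
    rw [hE, l2DistSq, intervalIntegral_eq_restrict_Icc hab.le,
      intervalIntegral_eq_restrict_Icc hab.le]
    exact integral_congr_ae (hder.mono fun y hy => by simp only [hy])
  have hE0 : 0 ≤ E := hE' ▸ l2DistSq_nonneg hab.le _ _
  have hosc : ∀ y ∈ Icc a b, (g x - g y) ^ 2 ≤ (b - a) * E := fun y hy => by
    have hsub : uIcc y x ⊆ uIcc a b := by
      rw [uIcc_of_le hab.le]; exact uIcc_subset_Icc hy hx
    have h1 : |g x - g y| ≤ ∫ x in a..b, |1 * deriv g x| := by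
      rw [← (hgac.mono hsub).integral_deriv_eq_sub]
      simp only [one_mul]
      refine (intervalIntegral.norm_integral_le_integral_norm_uIoc (f := deriv g)).trans ?_
      rw [intervalIntegral.integral_of_le hab.le]
      refine setIntegral_mono_set
        ((intervalIntegrable_iff_integrableOn_Ioc_of_le hab.le).1 hgac.intervalIntegrable_deriv).norm
        (ae_of_all _ fun _ => norm_nonneg _) (LE.le.eventuallyLE fun s hs => ?_)
      rw [mem_uIoc] at hs
      rcases hs with hs | hs
      · exact ⟨hy.1.trans_lt hs.1, hs.2.trans hx.2⟩
      · exact ⟨hx.1.trans_lt hs.1, hs.2.trans hy.2⟩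
    have h2 := h1.trans (integral_abs_mul_le hab.le (continuousOn_const.memLp_Icc) hL2)
    have h3 := pow_le_pow_left₀ (abs_nonneg _) h2 2
    rw [sq_abs, mul_pow, Real.sq_sqrt (intervalIntegral.integral_nonneg hab.le
      fun _ _ => sq_nonneg _), Real.sq_sqrt hE0] at h3
    simpa using h3
  have hgL2 : MemLp g 2 (volume.restrict (Icc a b)) :=
    ((hw.continuousOn hab.le).sub (hz.continuousOn hab.le)).memLp_Icc
  -- Average `g(x)² ≤ 2 g(y)² + 2 (g(x) - g(y))²` over `y`, with the oscillation already bounded by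
  -- Cauchy–Schwarz.
  have hmean : ∫ _ in a..b, g x ^ 2 ≤ ∫ y in a..b, (2 * g y ^ 2 + 2 * ((b - a) * E)) :=
    intervalIntegral.integral_mono_on hab.le intervalIntegrable_const
      (((hgL2.intervalIntegrable_sq hab.le).const_mul 2).add intervalIntegrable_const)
      fun y hy => by nlinarith [hosc y hy, sq_nonneg (g x - 2 * g y)]
  rw [intervalIntegral.integral_add ((hgL2.intervalIntegrable_sq hab.le).const_mul 2)
    intervalIntegrable_const, intervalIntegral.integral_const, intervalIntegral.integral_const,
    intervalIntegral.integral_const_mul, smul_eq_mul, smul_eq_mul] at hmean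
  have hba : 0 < b - a := sub_pos.2 hab
  have hL : 0 ≤ l2DistSq a b w z := l2DistSq_nonneg hab.le _ _
  have hgl : ∫ y in a..b, g y ^ 2 = l2DistSq a b w z := rfl
  have h1 : g x ^ 2 ≤ 2 / (b - a) * l2DistSq a b w z + 2 * (b - a) * E := by
    rw [← mul_le_mul_iff_right₀ hba]
    have : (b - a) * (2 / (b - a) * l2DistSq a b w z + 2 * (b - a) * E)
        = 2 * l2DistSq a b w z + (b - a) * (2 * ((b - a) * E)) := by field_simp
    linarith
  rw [h1DistSq, ← hE']
  have h2 : 0 ≤ 2 / (b - a) * E := by positivity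
  have h3 : 0 ≤ 2 * (b - a) * l2DistSq a b w z := by positivity
  linarith

end L2

theorem exists_lipschitz_Icc {I : Set ℝ} {φ : ℝ → ℝ} (hφ : ContDiffOn ℝ 1 φ I) {m M : ℝ}
    (hsub : Icc m M ⊆ I) :
    ∃ L, 0 ≤ L ∧ ∀ x ∈ Icc m M, ∀ y ∈ Icc m M, |φ x - φ y| ≤ L * |x - y| := by
  obtain ⟨L, hL⟩ := (hφ.mono hsub).exists_lipschitzOnWith one_ne_zero (convex_Icc m M) isCompact_Icc
  exact ⟨L, L.2, fun x hx y hy => hL.dist_le_mul x hx y hy⟩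

theorem exists_Icc_subset_of_isOpen {I : Set ℝ} (hI : IsOpen I) (hI' : I.OrdConnected) {m M : ℝ}
    (hmM : m ≤ M) (hsub : Icc m M ⊆ I) : ∃ η > 0, Icc (m - η) (M + η) ⊆ I := by
  obtain ⟨η₁, hη₁, h1⟩ := Metric.isOpen_iff.1 hI m (hsub (left_mem_Icc.2 hmM))
  obtain ⟨η₂, hη₂, h2⟩ := Metric.isOpen_iff.1 hI M (hsub (right_mem_Icc.2 hmM))
  rw [Real.ball_eq_Ioo] at h1 h2
  have hmin := lt_min hη₁ hη₂
  refine ⟨min η₁ η₂ / 2, half_pos hmin, hI'.out (h1 ⟨?_, ?_⟩) (h2 ⟨?_, ?_⟩)⟩ <;>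
    linarith [min_le_left η₁ η₂, min_le_right η₁ η₂]

theorem Admissible.contDiffOn_potential {I : Set ℝ} {α β : ℝ} {D f : ℝ → ℝ}
    (h : Admissible I α β D f) : ContDiffOn ℝ 1 (potential D f α) I := by
  rw [show (1 : WithTop ℕ∞) = 0 + 1 by norm_num, contDiffOn_succ_iff_deriv_of_isOpen h.isOpen]
  refine ⟨fun u hu => (h.hasDerivAt_potential hu).differentiableAt.differentiableWithinAt,
    by simp, ?_⟩
  rw [contDiffOn_zero]
  exact (h.continuousOn_f.mul h.continuousOn_D).congr fun u hu => (h.hasDerivAt_potential hu).deriv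

/-! ### Continuity in time of the solution, its flux and its energy -/

namespace IsSolution

variable {I : Set ℝ} {α β : ℝ} {D f : ℝ → ℝ} {a b ε : ℝ} {u₀ : ℝ → ℝ} {u : ℝ → ℝ → ℝ}

theorem exists_tendsto_abs_sub_le (hu : IsSolution I D f a b ε u₀ u) (hab : a < b) {t₀ : ℝ}
    (ht₀ : 0 ≤ t₀) : ∃ s : ℝ → ℝ, Tendsto s (𝓝[Ici 0] t₀) (𝓝 0) ∧ (∀ t, 0 ≤ s t) ∧
      ∀ t, 0 ≤ t → ∀ x ∈ Icc a b, |u t x - u t₀ x| ≤ s t := by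
  refine ⟨fun t => Real.sqrt ((2 / (b - a) + 2 * (b - a)) * h1DistSq a b (u t) (u t₀)), ?_,
    fun t => Real.sqrt_nonneg _, fun t ht x hx =>
      Real.abs_le_sqrt ((hu.memH1 t ht).sq_sub_le hab (hu.memH1 t₀ ht₀) hx)⟩
  simpa using ((hu.continuous_H1 t₀ ht₀).const_mul (2 / (b - a) + 2 * (b - a))).sqrt

/-- Uniform convergence in time keeps nearby slices in one compact part of `I`, where the
coefficients have common bounds and Lipschitz constants. -/
theorem exists_Icc_eventually (hu : IsSolution I D f a b ε u₀ u) (hI : IsOpen I)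
    (hI' : I.OrdConnected) (hab : a < b) {t₀ : ℝ} (ht₀ : 0 ≤ t₀) :
    ∃ m M, Icc m M ⊆ I ∧ ∀ᶠ t in 𝓝[Ici 0] t₀, ∀ x ∈ Icc a b, u t x ∈ Icc m M := by
  obtain ⟨m, M, hmM, hsub, hmem⟩ := exists_Icc_of_continuousOn hab.le hI'
    ((hu.memH1 t₀ ht₀).continuousOn hab.le) (hu.mem_I t₀ ht₀)
  obtain ⟨η, hη, hη'⟩ := exists_Icc_subset_of_isOpen hI hI' hmM hsub
  obtain ⟨s, hs, -, hle⟩ := hu.exists_tendsto_abs_sub_le hab ht₀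
  refine ⟨m - η, M + η, hη', ?_⟩
  filter_upwards [hs.eventually_lt_const hη, eventually_mem_nhdsWithin] with t hst ht x hx
  have h1 := abs_le.1 ((hle t ht x hx).trans hst.le)
  have h2 := hmem x hx
  exact ⟨by linarith [h2.1], by linarith [h2.2]⟩

theorem intervalIntegrable_abs_sub (hu : IsSolution I D f a b ε u₀ u) (hab : a < b) {t s : ℝ}
    (ht : 0 ≤ t) (hs : 0 ≤ s) : IntervalIntegrable (fun x => |u t x - u s x|) volume a b :=
  (((hu.memH1 t ht).continuousOn hab.le).sub
    ((hu.memH1 s hs).continuousOn hab.le)).abs.intervalIntegrable_of_Icc hab.le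

theorem tendsto_integral_abs_sub (hu : IsSolution I D f a b ε u₀ u) (hab : a < b) {t₀ : ℝ}
    (ht₀ : 0 ≤ t₀) :
    Tendsto (fun t => ∫ x in a..b, |u t x - u t₀ x|) (𝓝[Ici 0] t₀) (𝓝 0) := by
  obtain ⟨s, hs, -, hle⟩ := hu.exists_tendsto_abs_sub_le hab ht₀
  have hlim : Tendsto (fun t => (b - a) * s t) (𝓝[Ici 0] t₀) (𝓝 0) := by
    simpa using hs.const_mul (b - a)
  refine squeeze_zero' (Eventually.of_forall fun t =>
    intervalIntegral.integral_nonneg hab.le fun x _ => abs_nonneg _) ?_ hlim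
  filter_upwards [eventually_mem_nhdsWithin] with t ht
  have := intervalIntegral.integral_mono_on hab.le (hu.intervalIntegrable_abs_sub hab ht ht₀)
    intervalIntegrable_const (hle t ht)
  rwa [intervalIntegral.integral_const, smul_eq_mul] at this

/-- The difference of fluxes is `D(u) (u_x - u⁰_x) + (D(u) - D(u⁰)) u⁰_x`: a bounded factor times an
`L²`-small one, plus a uniformly small factor times a fixed `L²` function. -/
theorem tendsto_l2DistSq_flux (hDf : Admissible I α β D f) (hu : IsSolution I D f a b ε u₀ u)
    (hab : a < b) {t₀ : ℝ} (ht₀ : 0 ≤ t₀) :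
    Tendsto (fun t => l2DistSq a b (fun x => D (u t x) * dx a b (u t) x)
      (fun x => D (u t₀ x) * dx a b (u t₀) x)) (𝓝[Ici 0] t₀) (𝓝 0) := by
  obtain ⟨s, hs, hs0, hle⟩ := hu.exists_tendsto_abs_sub_le hab ht₀
  obtain ⟨m, M, hsub, hmem⟩ := hu.exists_Icc_eventually hDf.isOpen hDf.ordConnected hab ht₀
  obtain ⟨L, hL0, hL⟩ := exists_lipschitz_Icc (hDf.contDiffOn_D.of_le (by norm_num)) hsub
  obtain ⟨B, hB⟩ := isCompact_Icc.exists_bound_of_continuousOn (hDf.continuousOn_D.mono hsub)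
  have hmem₀ := hmem.self_of_nhdsWithin (mem_Ici.2 ht₀)
  set J := ∫ x in a..b, dx a b (u t₀) x ^ 2
  have hlim : Tendsto (fun t => 2 * B ^ 2 * h1DistSq a b (u t) (u t₀) + 2 * L ^ 2 * s t ^ 2 * J)
      (𝓝[Ici 0] t₀) (𝓝 0) := by
    have := ((hu.continuous_H1 t₀ ht₀).const_mul (2 * B ^ 2)).add
      (((hs.pow 2).const_mul (2 * L ^ 2)).mul_const J)
    simpa using this
  refine squeeze_zero' (Eventually.of_forall fun t => l2DistSq_nonneg hab.le _ _) ?_ hlim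
  filter_upwards [hmem, eventually_mem_nhdsWithin] with t hmt ht
  have hP := hDf.memLp_flux hab.le (hu.memH1 t ht) (hu.mem_I t ht)
  have hP₀ := hDf.memLp_flux hab.le (hu.memH1 t₀ ht₀) (hu.mem_I t₀ ht₀)
  have hd := ((hu.memH1 t ht).memLp_dx.sub (hu.memH1 t₀ ht₀).memLp_dx).intervalIntegrable_sq hab.le
  have hd₀ := (hu.memH1 t₀ ht₀).memLp_dx.intervalIntegrable_sq hab.le
  have hbound := intervalIntegral.integral_mono_on hab.le
    ((hP.sub hP₀).intervalIntegrable_sq hab.le)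
    ((hd.const_mul (2 * B ^ 2)).add (hd₀.const_mul (2 * L ^ 2 * s t ^ 2))) fun x hx => ?_
  · rw [intervalIntegral.integral_add (hd.const_mul _) (hd₀.const_mul _),
      intervalIntegral.integral_const_mul, intervalIntegral.integral_const_mul] at hbound
    refine hbound.trans (add_le_add_left (mul_le_mul_of_nonneg_left ?_ (by positivity)) _)
    exact le_add_of_nonneg_left (l2DistSq_nonneg hab.le _ _)
  · have h1 : |D (u t x)| ≤ B := hB _ (hmt x hx)
    have h2 : |D (u t x) - D (u t₀ x)| ≤ L * s t :=
      (hL _ (hmt x hx) _ (hmem₀ x hx)).trans (mul_le_mul_of_nonneg_left (hle t ht x hx) hL0)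
    have h1' := sq_le_sq' (abs_le.1 h1).1 (abs_le.1 h1).2
    have h2' := sq_le_sq' (abs_le.1 h2).1 (abs_le.1 h2).2
    simp only [Pi.sub_apply]
    calc (D (u t x) * dx a b (u t) x - D (u t₀ x) * dx a b (u t₀) x) ^ 2
        = (D (u t x) * (dx a b (u t) x - dx a b (u t₀) x)
          + (D (u t x) - D (u t₀ x)) * dx a b (u t₀) x) ^ 2 := by ring
      _ ≤ 2 * (D (u t x) ^ 2 * (dx a b (u t) x - dx a b (u t₀) x) ^ 2)
          + 2 * ((D (u t x) - D (u t₀ x)) ^ 2 * dx a b (u t₀) x ^ 2) := by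
        nlinarith [sq_nonneg (D (u t x) * (dx a b (u t) x - dx a b (u t₀) x)
          - (D (u t x) - D (u t₀ x)) * dx a b (u t₀) x)]
      _ ≤ 2 * (B ^ 2 * (dx a b (u t) x - dx a b (u t₀) x) ^ 2)
          + 2 * ((L * s t) ^ 2 * dx a b (u t₀) x ^ 2) := by gcongr
      _ = _ := by ring

theorem tendsto_energy (hDf : Admissible I α β D f) (hu : IsSolution I D f a b ε u₀ u)
    (hab : a < b) {t₀ : ℝ} (ht₀ : 0 ≤ t₀) :
    Tendsto (fun t => energy D f α a b ε (u t)) (𝓝[Ici 0] t₀)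
      (𝓝 (energy D f α a b ε (u t₀))) := by
  obtain ⟨s, hs, hs0, hle⟩ := hu.exists_tendsto_abs_sub_le hab ht₀
  obtain ⟨m, M, hsub, hmem⟩ := hu.exists_Icc_eventually hDf.isOpen hDf.ordConnected hab ht₀
  obtain ⟨L, hL0, hL⟩ := exists_lipschitz_Icc hDf.contDiffOn_potential hsub
  have hmem₀ := hmem.self_of_nhdsWithin (mem_Ici.2 ht₀)
  have hflux : ∀ t, 0 ≤ t → MemLp (fun x => D (u t x) * dx a b (u t) x) 2
      (volume.restrict (Icc a b)) := fun t ht =>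
    hDf.memLp_flux hab.le (hu.memH1 t ht) (hu.mem_I t ht)
  have hpot : ∀ t, 0 ≤ t → IntervalIntegrable (fun x => potential D f α (u t x)) volume a b :=
    fun t ht => hDf.intervalIntegrable_potential hab.le (hu.memH1 t ht) (hu.mem_I t ht)
  have hE : ∀ t, 0 ≤ t → energy D f α a b ε (u t) =
      ε / 2 * (∫ x in a..b, (D (u t x) * dx a b (u t) x) ^ 2)
        + (∫ x in a..b, potential D f α (u t x)) / ε := fun t ht => by
    rw [energy, intervalIntegral.integral_add
      (((hflux t ht).intervalIntegrable_sq hab.le).const_mul _) ((hpot t ht).div_const _),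
      intervalIntegral.integral_const_mul, intervalIntegral.integral_div]
  have h1 := tendsto_integral_sq hab.le (eventually_mem_nhdsWithin.mono hflux) (hflux t₀ ht₀)
    (hu.tendsto_l2DistSq_flux hDf hab ht₀)
  have h2 : Tendsto (fun t => ∫ x in a..b, potential D f α (u t x)) (𝓝[Ici 0] t₀)
      (𝓝 (∫ x in a..b, potential D f α (u t₀ x))) := by
    rw [tendsto_iff_dist_tendsto_zero]
    have hlim : Tendsto (fun t => (b - a) * (L * s t)) (𝓝[Ici 0] t₀) (𝓝 0) := by
      simpa using (hs.const_mul L).const_mul (b - a)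
    refine squeeze_zero' (Eventually.of_forall fun _ => dist_nonneg) ?_ hlim
    filter_upwards [hmem, eventually_mem_nhdsWithin] with t hmt ht
    rw [Real.dist_eq, ← intervalIntegral.integral_sub (hpot t ht) (hpot t₀ ht₀)]
    refine (intervalIntegral.abs_integral_le_integral_abs hab.le).trans ?_
    have := intervalIntegral.integral_mono_on hab.le ((hpot t ht).sub (hpot t₀ ht₀)).abs
      (intervalIntegrable_const (c := L * s t)) fun x hx =>
        (hL _ (hmt x hx) _ (hmem₀ x hx)).trans (mul_le_mul_of_nonneg_left (hle t ht x hx) hL0)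
    rwa [intervalIntegral.integral_const, smul_eq_mul] at this
  rw [hE t₀ ht₀]
  exact ((h1.const_mul _).add (h2.div_const _)).congr'
    (eventually_mem_nhdsWithin.mono fun t ht => (hE t ht).symm)

end IsSolution

/-! ### The Kirchhoff transform and the expansion of the energy -/

theorem MemH1.differentiableAt_ae {a b : ℝ} (hab : a ≤ b) {w : ℝ → ℝ} (hw : MemH1 a b w) :
    ∀ᵐ x ∂volume.restrict (Icc a b), x ∈ Ioo a b ∧ HasDerivAt w (dx a b w x) x := by
  rw [← Measure.restrict_congr_set (Ioo_ae_eq_Icc (μ := volume) (a := a) (b := b))]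
  filter_upwards [ae_restrict_mem measurableSet_Ioo,
    ae_restrict_of_ae hw.absolutelyContinuous.ae_differentiableAt] with x hx hd
  refine ⟨hx, ?_⟩
  rw [dx_eq_deriv hx]
  exact (hd (by rw [uIcc_of_le hab]; exact Ioo_subset_Icc_self hx)).hasDerivAt

/-- The Kirchhoff transform `ψ(u) = ∫_α^u D(s) ds`. -/
noncomputable def kirchhoff (D : ℝ → ℝ) (α u : ℝ) : ℝ := ∫ s in α..u, D s

namespace Admissible

variable {I : Set ℝ} {α β : ℝ} {D f : ℝ → ℝ} {a b ε : ℝ} {w z : ℝ → ℝ}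

theorem contDiffOn_D_one (h : Admissible I α β D f) : ContDiffOn ℝ 1 D I :=
  h.contDiffOn_D.of_le (by norm_num)

theorem contDiffOn_f_one (h : Admissible I α β D f) : ContDiffOn ℝ 1 f I :=
  h.contDiffOn_f.of_le (by norm_num)

theorem hasDerivAt_D (h : Admissible I α β D f) {u : ℝ} (hu : u ∈ I) :
    HasDerivAt D (deriv D u) u :=
  ((h.contDiffOn_D.contDiffAt (h.isOpen.mem_nhds hu)).differentiableAt (by norm_num)).hasDerivAt

theorem hasDerivAt_kirchhoff (h : Admissible I α β D f) {u : ℝ} (hu : u ∈ I) :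
    HasDerivAt (kirchhoff D α) (D u) u :=
  hasDerivAt_integral_of_continuousOn h.isOpen h.ordConnected h.continuousOn_D h.left_mem hu

theorem contDiffOn_kirchhoff (h : Admissible I α β D f) :
    ContDiffOn ℝ 1 (kirchhoff D α) I := by
  rw [show (1 : WithTop ℕ∞) = 0 + 1 by norm_num, contDiffOn_succ_iff_deriv_of_isOpen h.isOpen]
  refine ⟨fun u hu => (h.hasDerivAt_kirchhoff hu).differentiableAt.differentiableWithinAt,
    by simp, ?_⟩
  rw [contDiffOn_zero]
  exact h.continuousOn_D.congr fun u hu => (h.hasDerivAt_kirchhoff hu).deriv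

/-- Since `dψ = D du` and `dG = f dψ`, both are first-order expansions with quadratic error. Taking
`ψ` as the variable makes `f` the derivative of the potential. -/
theorem exists_taylor_bounds (h : Admissible I α β D f) {m M : ℝ} (hsub : Icc m M ⊆ I) :
    ∃ C, 0 ≤ C ∧ ∀ p ∈ Icc m M, ∀ q ∈ Icc m M,
      |kirchhoff D α p - kirchhoff D α q - D q * (p - q)| ≤ C * (p - q) ^ 2 ∧
      f q * (kirchhoff D α p - kirchhoff D α q) - C * (p - q) ^ 2
        ≤ potential D f α p - potential D f α q := by
  obtain ⟨L, hL0, hL⟩ := exists_lipschitz_Icc h.contDiffOn_D_one hsub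
  obtain ⟨L', hL0', hL'⟩ := exists_lipschitz_Icc h.contDiffOn_f_one hsub
  obtain ⟨B, hB⟩ := isCompact_Icc.exists_bound_of_continuousOn (h.continuousOn_D.mono hsub)
  refine ⟨max L (L' * B), le_max_of_le_left hL0, fun p hp q hq => ?_⟩
  have hqp : uIcc q p ⊆ Icc m M := uIcc_subset_Icc hq hp
  have hDint : ∀ x ∈ I, ∀ y ∈ I, IntervalIntegrable D volume x y := fun x hx y hy =>
    (h.continuousOn_D.mono (h.ordConnected.uIcc_subset hx hy)).intervalIntegrable
  have hfDint : ∀ x ∈ I, ∀ y ∈ I, IntervalIntegrable (fun s => f s * D s) volume x y :=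
    fun x hx y hy => ((h.continuousOn_f.mul h.continuousOn_D).mono
      (h.ordConnected.uIcc_subset hx hy)).intervalIntegrable
  have hψ : kirchhoff D α p - kirchhoff D α q = ∫ s in q..p, D s :=
    intervalIntegral.integral_interval_sub_left (hDint _ h.left_mem _ (hsub hp))
      (hDint _ h.left_mem _ (hsub hq))
  have hG : potential D f α p - potential D f α q = ∫ s in q..p, f s * D s :=
    intervalIntegral.integral_interval_sub_left (hfDint _ h.left_mem _ (hsub hp))
      (hfDint _ h.left_mem _ (hsub hq))
  have hsq : ∀ s ∈ uIoc q p, |s - q| ≤ |p - q| := fun s hs =>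
    abs_sub_left_of_mem_uIcc (uIoc_subset_uIcc hs)
  rw [hψ, hG]
  constructor
  · have h1 : (∫ s in q..p, D s) - D q * (p - q) = ∫ s in q..p, (D s - D q) := by
      rw [intervalIntegral.integral_sub (hDint _ (hsub hq) _ (hsub hp)) intervalIntegrable_const,
        intervalIntegral.integral_const, smul_eq_mul, mul_comm]
    rw [h1]
    have h2 : ‖∫ s in q..p, (D s - D q)‖ ≤ L * |p - q| * |p - q| :=
      intervalIntegral.norm_integral_le_of_norm_le_const fun s hs =>
        (hL s (hqp (uIoc_subset_uIcc hs)) q hq).trans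
          (mul_le_mul_of_nonneg_left (hsq s hs) hL0)
    rw [mul_assoc, ← sq, sq_abs, Real.norm_eq_abs] at h2
    exact h2.trans (mul_le_mul_of_nonneg_right (le_max_left _ _) (sq_nonneg _))
  · have h1 : (∫ s in q..p, f s * D s) - f q * (∫ s in q..p, D s)
        = ∫ s in q..p, (f s - f q) * D s := by
      rw [← intervalIntegral.integral_const_mul, ← intervalIntegral.integral_sub
        (hfDint _ (hsub hq) _ (hsub hp)) ((hDint _ (hsub hq) _ (hsub hp)).const_mul _)]
      simp only [sub_mul]
    have h2 : ‖∫ s in q..p, (f s - f q) * D s‖ ≤ L' * |p - q| * B * |p - q| :=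
      intervalIntegral.norm_integral_le_of_norm_le_const fun s hs => by
        have hs' := hqp (uIoc_subset_uIcc hs)
        rw [norm_mul]
        exact mul_le_mul ((hL' s hs' q hq).trans
          (mul_le_mul_of_nonneg_left (hsq s hs) hL0')) (hB s hs') (norm_nonneg _) (by positivity)
    have h3 : L' * |p - q| * B * |p - q| = L' * B * (p - q) ^ 2 := by
      rw [← sq_abs (p - q)]; ring
    rw [h3, Real.norm_eq_abs, ← h1] at h2
    have h4 := mul_le_mul_of_nonneg_right (le_max_right L (L' * B)) (sq_nonneg (p - q))
    linarith [(abs_le.1 h2).1]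

theorem memH1_flux (h : Admissible I α β D f) (hab : a < b) (hz : MemH2 a b z)
    (hzI : ∀ x ∈ Icc a b, z x ∈ I) : MemH1 a b (fun x => D (z x) * dx a b z x) := by
  have hac : AbsolutelyContinuousOnInterval (fun x => D (z x) * dx a b z x) a b :=
    (hz.memH1.absolutelyContinuous_comp hab.le h.ordConnected hzI h.contDiffOn_D_one).fun_mul
      hz.memH1_dx.absolutelyContinuous
  refine ⟨hac, ?_⟩
  have hcz := hz.memH1.continuousOn hab.le
  have hcdz := hz.memH1_dx.continuousOn hab.le
  have hcD' : ContinuousOn (fun x => deriv D (z x)) (Icc a b) :=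
    (h.contDiffOn_D.continuousOn_deriv_of_isOpen h.isOpen (by norm_num)).comp hcz hzI
  have hL2 : MemLp (fun x => deriv D (z x) * dx a b z x * dx a b z x
      + D (z x) * dx a b (dx a b z) x) 2 (volume.restrict (Icc a b)) :=
    (((hcD'.mul hcdz).mul hcdz).memLp_Icc).add
      (hz.memH1_dx.memLp_dx.continuousOn_mul (h.continuousOn_D.comp hcz hzI))
  refine hL2.ae_eq ?_
  filter_upwards [hz.memH1.differentiableAt_ae hab.le, hz.memH1_dx.differentiableAt_ae hab.le]
    with x h1 h2
  rw [dx_eq_deriv h1.1 (fun x => D (z x) * dx a b z x)]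
  exact ((((h.hasDerivAt_D (hzI x (Ioo_subset_Icc_self h1.1))).comp x h1.2).mul h2.2).deriv).symm

theorem memLp_rhs (h : Admissible I α β D f) (hab : a < b) (hz : MemH2 a b z)
    (hzI : ∀ x ∈ Icc a b, z x ∈ I) :
    MemLp (fun x => ε ^ 2 * dx a b (fun y => D (z y) * dx a b z y) x - f (z x)) 2
      (volume.restrict (Icc a b)) :=
  ((h.memH1_flux hab hz hzI).memLp_dx.const_mul _).sub
    (h.continuousOn_f.comp (hz.memH1.continuousOn hab.le) hzI).memLp_Icc

theorem absolutelyContinuous_kirchhoff_sub (h : Admissible I α β D f) (hab : a < b)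
    (hw : MemH1 a b w) (hwI : ∀ x ∈ Icc a b, w x ∈ I) (hz : MemH1 a b z)
    (hzI : ∀ x ∈ Icc a b, z x ∈ I) :
    AbsolutelyContinuousOnInterval
      (fun x => kirchhoff D α (w x) - kirchhoff D α (z x)) a b ∧
    ∀ᵐ x ∂volume.restrict (Icc a b),
      deriv (fun x => kirchhoff D α (w x) - kirchhoff D α (z x)) x
        = D (w x) * dx a b w x - D (z x) * dx a b z x := by
  refine ⟨(hw.absolutelyContinuous_comp hab.le h.ordConnected hwI h.contDiffOn_kirchhoff).fun_sub
    (hz.absolutelyContinuous_comp hab.le h.ordConnected hzI h.contDiffOn_kirchhoff), ?_⟩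
  filter_upwards [hw.differentiableAt_ae hab.le, hz.differentiableAt_ae hab.le] with x h1 h2
  have hx := Ioo_subset_Icc_self h1.1
  exact (((h.hasDerivAt_kirchhoff (hwI x hx)).comp x h1.2).sub
    ((h.hasDerivAt_kirchhoff (hzI x hx)).comp x h2.2)).deriv

theorem _root_.AllenCahn.MemH1.integral_mul_deriv_eq_neg (hab : a < b) {p₀ Ψ : ℝ → ℝ}
    (hp₀ : MemH1 a b p₀) (hΨ : AbsolutelyContinuousOnInterval Ψ a b) (h1 : p₀ a = 0)
    (h2 : p₀ b = 0) : ∫ x in a..b, p₀ x * deriv Ψ x = -∫ x in a..b, Ψ x * dx a b p₀ x := by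
  rw [hp₀.absolutelyContinuous.integral_mul_deriv_eq_deriv_mul hΨ, h1, h2, zero_mul, zero_mul,
    sub_zero, zero_sub, intervalIntegral_eq_restrict_Icc hab.le,
    intervalIntegral_eq_restrict_Icc hab.le]
  congr 1
  refine integral_congr_ae ((hp₀.differentiableAt_ae hab.le).mono fun x hx => ?_)
  beta_reduce
  rw [hx.2.deriv, mul_comm]

/-- For the fluxes, `p² - p₀² = 2 p₀ (p - p₀) + (p - p₀)²`, and the last square is dropped. Thus no
smallness of `w_x - z_x` is needed. -/
theorem _root_.AllenCahn.le_density_sub (hε : 0 < ε) {C Ψ Ψ' x : ℝ}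
    (hΨ' : Ψ' = D (w x) * dx a b w x - D (z x) * dx a b z x)
    (hC : f (z x) * Ψ - C * (w x - z x) ^ 2 ≤ potential D f α (w x) - potential D f α (z x)) :
    ε * (D (z x) * dx a b z x * Ψ') + 1 / ε * (Ψ * f (z x)) - C / ε * (w x - z x) ^ 2
      ≤ density D f α a b ε w x - density D f α a b ε z x := by
  rw [hΨ', density, density]
  generalize D (w x) * dx a b w x = p
  generalize D (z x) * dx a b z x = p₀
  have h1 := div_le_div_of_nonneg_right hC hε.le
  have h2 : 0 ≤ ε / 2 * (p - p₀) ^ 2 := by positivity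
  have h3 : (f (z x) * Ψ - C * (w x - z x) ^ 2) / ε
      = 1 / ε * (Ψ * f (z x)) - C / ε * (w x - z x) ^ 2 := by ring
  rw [h3, sub_div] at h1
  linarith

/-- Integrate the pointwise bound and move the derivative from `Ψ` to the flux of `z`; the boundary
terms vanish by the Neumann conditions. Only `z` has to be in `H²`. -/
theorem sub_le_energy_sub_of_primitive (h : Admissible I α β D f) (hab : a < b) (hε : 0 < ε)
    (hw : MemH1 a b w) (hwI : ∀ x ∈ Icc a b, w x ∈ I) (hz : MemH2 a b z)
    (hzI : ∀ x ∈ Icc a b, z x ∈ I) (hza : dx a b z a = 0) (hzb : dx a b z b = 0) {C : ℝ}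
    {Ψ : ℝ → ℝ} (hΨac : AbsolutelyContinuousOnInterval Ψ a b)
    (hΨd : ∀ᵐ x ∂volume.restrict (Icc a b),
      deriv Ψ x = D (w x) * dx a b w x - D (z x) * dx a b z x)
    (hC : ∀ x ∈ Icc a b, f (z x) * Ψ x - C * (w x - z x) ^ 2
      ≤ potential D f α (w x) - potential D f α (z x)) :
    -(1 / ε) * (∫ x in a..b, Ψ x *
        (ε ^ 2 * dx a b (fun y => D (z y) * dx a b z y) x - f (z x)))
      - C / ε * (∫ x in a..b, (w x - z x) ^ 2)
      ≤ energy D f α a b ε w - energy D f α a b ε z := by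
  have hpH1 := h.memH1_flux hab hz hzI
  have hpL2 := h.memLp_flux hab.le hw hwI
  have hpL2₀ := h.memLp_flux hab.le hz.memH1 hzI
  have hcw := hw.continuousOn hab.le
  have hcz := hz.memH1.continuousOn hab.le
  have hΨc := hΨac.continuousOn
  rw [uIcc_of_le hab.le] at hΨc
  have i1 : IntervalIntegrable (fun x => D (z x) * dx a b z x * deriv Ψ x) volume a b :=
    hpL2₀.intervalIntegrable_mul hab.le ((hpL2.sub hpL2₀).ae_eq (hΨd.mono fun x hx => hx.symm))
  have i2 : IntervalIntegrable (fun x => Ψ x * f (z x)) volume a b :=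
    (hΨc.mul (h.continuousOn_f.comp hcz hzI)).intervalIntegrable_of_Icc hab.le
  have i3 : IntervalIntegrable (fun x => (w x - z x) ^ 2) volume a b :=
    ((hcw.sub hcz).pow 2).intervalIntegrable_of_Icc hab.le
  have i4 := hΨc.memLp_Icc.intervalIntegrable_mul hab.le hpH1.memLp_dx
  have i5 := h.intervalIntegrable_density (ε := ε) hab.le hw hwI
  have i6 := h.intervalIntegrable_density (ε := ε) hab.le hz.memH1 hzI
  have hmono := intervalIntegral.integral_mono_ae_restrict hab.le
      (((i1.const_mul ε).add (i2.const_mul (1 / ε))).sub (i3.const_mul (C / ε))) (i5.sub i6) (by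
    filter_upwards [hΨd, ae_restrict_mem measurableSet_Icc] with x hx hxm
    exact le_density_sub hε hx (hC x hxm))
  rw [intervalIntegral.integral_sub i5 i6, ← energy_eq_integral_density,
    ← energy_eq_integral_density, intervalIntegral.integral_sub
      ((i1.const_mul _).add (i2.const_mul _)) (i3.const_mul _), intervalIntegral.integral_add
      (i1.const_mul _) (i2.const_mul _), intervalIntegral.integral_const_mul,
    intervalIntegral.integral_const_mul, intervalIntegral.integral_const_mul,
    hpH1.integral_mul_deriv_eq_neg hab hΨac (by simp [hza]) (by simp [hzb])] at hmono
  have hρ : ∫ x in a..b, Ψ x * (ε ^ 2 * dx a b (fun y => D (z y) * dx a b z y) x - f (z x)) =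
      ε ^ 2 * (∫ x in a..b, Ψ x * dx a b (fun y => D (z y) * dx a b z y) x)
        - ∫ x in a..b, Ψ x * f (z x) := by
    rw [← intervalIntegral.integral_const_mul, ← intervalIntegral.integral_sub (i4.const_mul _) i2]
    exact intervalIntegral.integral_congr fun x _ => by ring
  rw [hρ]
  refine le_trans (le_of_eq ?_) hmono
  generalize (∫ x in a..b, Ψ x * dx a b (fun y => D (z y) * dx a b z y) x) = J
  field_simp
  ring

theorem sub_le_energy_sub (h : Admissible I α β D f) (hab : a < b) (hε : 0 < ε)
    (hw : MemH1 a b w) (hwI : ∀ x ∈ Icc a b, w x ∈ I) (hz : MemH2 a b z)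
    (hzI : ∀ x ∈ Icc a b, z x ∈ I) (hza : dx a b z a = 0) (hzb : dx a b z b = 0) {C : ℝ}
    (hC : ∀ x ∈ Icc a b, f (z x) * (kirchhoff D α (w x) - kirchhoff D α (z x))
      - C * (w x - z x) ^ 2 ≤ potential D f α (w x) - potential D f α (z x)) :
    -(1 / ε) * (∫ x in a..b, (kirchhoff D α (w x) - kirchhoff D α (z x)) *
        (ε ^ 2 * dx a b (fun y => D (z y) * dx a b z y) x - f (z x)))
      - C / ε * (∫ x in a..b, (w x - z x) ^ 2)
      ≤ energy D f α a b ε w - energy D f α a b ε z :=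
  have hΨ := h.absolutelyContinuous_kirchhoff_sub hab hw hwI hz.memH1 hzI
  h.sub_le_energy_sub_of_primitive hab hε hw hwI hz hzI hza hzb hΨ.1 hΨ.2 hC

end Admissible

/-- The right-hand side `ε² (D(w) w_x)_x - f(w)` of the equation. -/
noncomputable def rhs (D f : ℝ → ℝ) (a b ε : ℝ) (w : ℝ → ℝ) (x : ℝ) : ℝ :=
  ε ^ 2 * dx a b (fun y => D (w y) * dx a b w y) x - f (w x)

/-! ### Energy dissipation and the distance travelled -/

namespace IsSolution

variable {I : Set ℝ} {α β : ℝ} {D f : ℝ → ℝ} {a b ε : ℝ} {u₀ : ℝ → ℝ} {u : ℝ → ℝ → ℝ}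

theorem nhdsLT_le_nhdsGE {t₀ : ℝ} (ht₀ : 0 < t₀) : 𝓝[<] t₀ ≤ 𝓝[Ici 0] t₀ :=
  le_inf nhdsWithin_le_nhds (le_principal_iff.2 (mem_nhdsWithin_of_mem_nhds (Ici_mem_nhds ht₀)))

theorem memLp_rhs (hDf : Admissible I α β D f) (hu : IsSolution I D f a b ε u₀ u)
    (hab : a < b) {t₀ : ℝ} (ht₀ : 0 < t₀) :
    MemLp (rhs D f a b ε (u t₀)) 2 (volume.restrict (Icc a b)) :=
  hDf.memLp_rhs hab (hu.memH2 t₀ ht₀) (hu.mem_I t₀ ht₀.le)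

theorem continuousOn_slice (hu : IsSolution I D f a b ε u₀ u) (hab : a < b) {t : ℝ} (ht : 0 ≤ t) :
    ContinuousOn (u t) (Icc a b) := (hu.memH1 t ht).continuousOn hab.le

theorem continuousOn_quotient (hu : IsSolution I D f a b ε u₀ u) (hab : a < b) {t t₀ : ℝ}
    (ht : 0 ≤ t) (ht₀ : 0 ≤ t₀) :
    ContinuousOn (fun x => (u t x - u t₀ x) / (t - t₀)) (Icc a b) :=
  ((hu.continuousOn_slice hab ht).sub (hu.continuousOn_slice hab ht₀)).div_const _

theorem eventually_memLp_quotient (hu : IsSolution I D f a b ε u₀ u) (hab : a < b) {t₀ : ℝ}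
    (ht₀ : 0 < t₀) : ∀ᶠ t in 𝓝[<] t₀,
      MemLp (fun x => (u t x - u t₀ x) / (t - t₀)) 2 (volume.restrict (Icc a b)) :=
  (eventually_mem_nhdsWithin.filter_mono (nhdsLT_le_nhdsGE ht₀)).mono fun _ ht =>
    (hu.continuousOn_quotient hab ht ht₀.le).memLp_Icc

theorem tendsto_quotient (hu : IsSolution I D f a b ε u₀ u) {t₀ : ℝ} (ht₀ : 0 < t₀) :
    Tendsto (fun t => l2DistSq a b (fun x => (u t x - u t₀ x) / (t - t₀))
      (rhs D f a b ε (u t₀))) (𝓝[<] t₀) (𝓝 0) :=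
  (hu.equation t₀ ht₀).mono_left (nhdsWithin_mono _ fun _ hx => ne_of_lt hx)

theorem tendsto_integral_quotient_mul (hDf : Admissible I α β D f)
    (hu : IsSolution I D f a b ε u₀ u) (hab : a < b) {t₀ : ℝ} (ht₀ : 0 < t₀) {g : ℝ → ℝ}
    (hg : MemLp g 2 (volume.restrict (Icc a b))) :
    Tendsto (fun t => ∫ x in a..b, (u t x - u t₀ x) / (t - t₀) * g x) (𝓝[<] t₀)
      (𝓝 (∫ x in a..b, rhs D f a b ε (u t₀) x * g x)) :=
  tendsto_integral_mul hab.le (hu.eventually_memLp_quotient hab ht₀) (hu.memLp_rhs hDf hab ht₀) hg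
    (hu.tendsto_quotient ht₀)

/-- Replacing `ψ(u t) - ψ(u t₀)` by `D(u t₀) (u t - u t₀)` leaves a quadratic error: one factor
tends to zero uniformly, the other, divided by `t - t₀`, stays bounded in `L²`. -/
theorem tendsto_integral_kirchhoff_quotient_mul (hDf : Admissible I α β D f)
    (hu : IsSolution I D f a b ε u₀ u) (hab : a < b) {t₀ : ℝ} (ht₀ : 0 < t₀) :
    Tendsto (fun t => ∫ x in a..b, (kirchhoff D α (u t x) - kirchhoff D α (u t₀ x)) / (t - t₀)
        * rhs D f a b ε (u t₀) x) (𝓝[<] t₀)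
      (𝓝 (∫ x in a..b, D (u t₀ x) * rhs D f a b ε (u t₀) x ^ 2)) := by
  have hρ := hu.memLp_rhs hDf hab ht₀
  have hc₀ := hu.continuousOn_slice hab ht₀.le
  have hDρ : MemLp (fun x => D (u t₀ x) * rhs D f a b ε (u t₀) x) 2 (volume.restrict (Icc a b)) :=
    hρ.continuousOn_mul (hDf.continuousOn_D.comp hc₀ (hu.mem_I t₀ ht₀.le))
  have hmain := hu.tendsto_integral_quotient_mul hDf hab ht₀ hDρ
  have hval : ∫ x in a..b, rhs D f a b ε (u t₀) x * (D (u t₀ x) * rhs D f a b ε (u t₀) x) =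
      ∫ x in a..b, D (u t₀ x) * rhs D f a b ε (u t₀) x ^ 2 :=
    intervalIntegral.integral_congr fun x _ => by ring
  rw [hval] at hmain
  obtain ⟨s, hs, hs0, hle⟩ := hu.exists_tendsto_abs_sub_le hab ht₀.le
  obtain ⟨m, M, hsub, hmem⟩ := hu.exists_Icc_eventually hDf.isOpen hDf.ordConnected hab ht₀.le
  obtain ⟨C, hC0, hC⟩ := hDf.exists_taylor_bounds hsub
  have hmem₀ := hmem.self_of_nhdsWithin (mem_Ici.2 ht₀.le)
  set ρ := rhs D f a b ε (u t₀)
  have hq2 := tendsto_integral_sq hab.le (hu.eventually_memLp_quotient hab ht₀) hρ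
    (hu.tendsto_quotient ht₀)
  have hlim : Tendsto (fun t => C * s t *
      (Real.sqrt (∫ x in a..b, ((u t x - u t₀ x) / (t - t₀)) ^ 2)
        * Real.sqrt (∫ x in a..b, ρ x ^ 2))) (𝓝[<] t₀) (𝓝 0) := by
    have := ((hs.mono_left (nhdsLT_le_nhdsGE ht₀)).const_mul C).mul
      (hq2.sqrt.mul_const (Real.sqrt (∫ x in a..b, ρ x ^ 2)))
    simpa using this
  refine tendsto_of_tendsto_of_dist hmain (squeeze_zero' (Eventually.of_forall
    fun _ => dist_nonneg) ?_ hlim)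
  filter_upwards [nhdsLT_le_nhdsGE ht₀ hmem, nhdsLT_le_nhdsGE ht₀ eventually_mem_nhdsWithin,
    eventually_mem_nhdsWithin] with t hmt ht htt₀
  have hne : |t - t₀| ≠ 0 := abs_ne_zero.2 (sub_ne_zero.2 (ne_of_lt htt₀))
  have hq := hu.continuousOn_quotient hab ht ht₀.le
  have hk : ContinuousOn (fun x => (kirchhoff D α (u t x) - kirchhoff D α (u t₀ x)) / (t - t₀))
      (Icc a b) := by
    have hkc := hDf.contDiffOn_kirchhoff.continuousOn
    exact ((hkc.comp (hu.continuousOn_slice hab ht) (hu.mem_I t ht)).sub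
      (hkc.comp hc₀ (hu.mem_I t₀ ht₀.le))).div_const _
  have i1 := hq.memLp_Icc.intervalIntegrable_mul hab.le hDρ
  have i2 := hk.memLp_Icc.intervalIntegrable_mul hab.le hρ
  have i3 := hq.memLp_Icc.intervalIntegrable_mul hab.le hρ
  rw [Real.dist_eq, ← intervalIntegral.integral_sub i1 i2]
  refine (intervalIntegral.abs_integral_le_integral_abs hab.le).trans ?_
  have hmono := intervalIntegral.integral_mono_on hab.le (i1.sub i2).abs
    (i3.abs.const_mul (C * s t)) fun x hx => ?_
  · rw [intervalIntegral.integral_const_mul] at hmono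
    exact hmono.trans (mul_le_mul_of_nonneg_left (integral_abs_mul_le hab.le hq.memLp_Icc hρ)
      (mul_nonneg hC0 (hs0 t)))
  · have h1 := (hC _ (hmt x hx) _ (hmem₀ x hx)).1
    have h2 : (u t x - u t₀ x) / (t - t₀) * (D (u t₀ x) * ρ x)
        - (kirchhoff D α (u t x) - kirchhoff D α (u t₀ x)) / (t - t₀) * ρ x
        = -((kirchhoff D α (u t x) - kirchhoff D α (u t₀ x) - D (u t₀ x) * (u t x - u t₀ x))
          / (t - t₀) * ρ x) := by ring
    rw [h2, abs_neg, abs_mul, abs_mul, abs_div, abs_div, ← mul_assoc]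
    refine mul_le_mul_of_nonneg_right ?_ (abs_nonneg _)
    rw [← mul_div_assoc]
    refine div_le_div_of_nonneg_right (h1.trans ?_) (abs_nonneg _)
    rw [← sq_abs, sq, ← mul_assoc]
    exact mul_le_mul_of_nonneg_right (mul_le_mul_of_nonneg_left (hle t ht x hx) hC0)
      (abs_nonneg _)

/-- A lower bound for `E[u t] - E[u t₀]` with `t < t₀` is an upper bound for the left slope. This
one-sided dissipation estimate replaces differentiability of the energy in time. -/
theorem exists_left_slope_energy_le (hDf : Admissible I α β D f)
    (hu : IsSolution I D f a b ε u₀ u) (hab : a < b) (hε : 0 < ε) {t₀ : ℝ} (ht₀ : 0 < t₀) :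
    ∃ S : ℝ → ℝ, Tendsto S (𝓝[<] t₀)
        (𝓝 (-(1 / ε) * ∫ x in a..b, D (u t₀ x) * rhs D f a b ε (u t₀) x ^ 2)) ∧
      ∀ᶠ t in 𝓝[<] t₀, (energy D f α a b ε (u t₀) - energy D f α a b ε (u t)) / (t₀ - t) ≤ S t := by
  obtain ⟨m, M, hsub, hmem⟩ := hu.exists_Icc_eventually hDf.isOpen hDf.ordConnected hab ht₀.le
  obtain ⟨C, hC0, hC⟩ := hDf.exists_taylor_bounds hsub
  have hmem₀ := hmem.self_of_nhdsWithin (mem_Ici.2 ht₀.le)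
  have hq2 := tendsto_integral_sq hab.le (hu.eventually_memLp_quotient hab ht₀)
    (hu.memLp_rhs hDf hab ht₀) (hu.tendsto_quotient ht₀)
  have hsubt : Tendsto (fun t => t - t₀) (𝓝[<] t₀) (𝓝 0) := by
    have : Tendsto (fun t => t - t₀) (𝓝 t₀) (𝓝 (t₀ - t₀)) := tendsto_id.sub_const t₀
    rw [sub_self] at this
    exact this.mono_left nhdsWithin_le_nhds
  refine ⟨fun t => -(1 / ε) * (∫ x in a..b, (kirchhoff D α (u t x) - kirchhoff D α (u t₀ x))
      / (t - t₀) * rhs D f a b ε (u t₀) x)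
    - C / ε * ((t - t₀) * ∫ x in a..b, ((u t x - u t₀ x) / (t - t₀)) ^ 2), ?_, ?_⟩
  · have := ((hu.tendsto_integral_kirchhoff_quotient_mul hDf hab ht₀).const_mul (-(1 / ε))).sub
      ((hsubt.mul hq2).const_mul (C / ε))
    simpa only [zero_mul, mul_zero, sub_zero] using this
  · filter_upwards [nhdsLT_le_nhdsGE ht₀ hmem, nhdsLT_le_nhdsGE ht₀ eventually_mem_nhdsWithin,
      eventually_mem_nhdsWithin] with t hmt ht htt₀
    have hneg : 0 < t₀ - t := sub_pos.2 htt₀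
    have key := hDf.sub_le_energy_sub hab hε (hu.memH1 t ht) (hu.mem_I t ht) (hu.memH2 t₀ ht₀)
      (hu.mem_I t₀ ht₀.le) (hu.neumann_left t₀ ht₀) (hu.neumann_right t₀ ht₀) (C := C)
      fun x hx => (hC _ (hmt x hx) _ (hmem₀ x hx)).2
    have e1 : ∫ x in a..b, (kirchhoff D α (u t x) - kirchhoff D α (u t₀ x))
        / (t - t₀) * rhs D f a b ε (u t₀) x = (∫ x in a..b, (kirchhoff D α (u t x)
          - kirchhoff D α (u t₀ x)) * rhs D f a b ε (u t₀) x) / (t - t₀) := by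
      rw [← intervalIntegral.integral_div]
      exact intervalIntegral.integral_congr fun x _ => by ring
    have e2 : ∫ x in a..b, ((u t x - u t₀ x) / (t - t₀)) ^ 2
        = (∫ x in a..b, (u t x - u t₀ x) ^ 2) / (t - t₀) ^ 2 := by
      rw [← intervalIntegral.integral_div]
      exact intervalIntegral.integral_congr fun x _ => div_pow _ _ _
    rw [e1, e2, div_le_iff₀ hneg]
    change -(1 / ε) * (∫ x in a..b, (kirchhoff D α (u t x) - kirchhoff D α (u t₀ x)) *
        rhs D f a b ε (u t₀) x) - C / ε * (∫ x in a..b, (u t x - u t₀ x) ^ 2) ≤ _ at key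
    generalize (∫ x in a..b, (kirchhoff D α (u t x) - kirchhoff D α (u t₀ x)) *
        rhs D f a b ε (u t₀) x) = X at *
    generalize (∫ x in a..b, (u t x - u t₀ x) ^ 2) = Y at *
    have hne : t - t₀ ≠ 0 := by linarith
    have e3 : (-(1 / ε) * (X / (t - t₀)) - C / ε * ((t - t₀) * (Y / (t - t₀) ^ 2))) * (t₀ - t)
        = -(-(1 / ε) * X - C / ε * Y) := by
      field_simp
      ring
    rw [e3]
    linarith

/-- The `L¹` distance travelled by a solution is controlled by the dissipated energy. -/
theorem integral_abs_sub_le (hDf : Admissible I α β D f) (hu : IsSolution I D f a b ε u₀ u)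
    (hab : a < b) (hε : 0 < ε) {d : ℝ} (hd : 0 < d) (hD : ∀ y ∈ I, d ≤ D y) {s t c : ℝ}
    (hs : 0 ≤ s) (hst : s ≤ t) (hc : 0 < c) :
    ∫ x in a..b, |u t x - u s x| ≤ c * (b - a) * (t - s) / 2
      + ε / (2 * c * d) * (energy D f α a b ε (u s) - energy D f α a b ε (u t)) := by
  have ht : 0 ≤ t := hs.trans hst
  have hcont : ∀ τ, 0 ≤ τ → ContinuousOn (u τ) (Icc a b) := fun τ hτ =>
    hu.continuousOn_slice hab hτ
  -- The sign of the total increment, equal to 0 where the increment vanishes; testing with it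
  -- yields the `L¹` norm.
  set g : ℝ → ℝ := fun x => (u t x - u s x) / |u t x - u s x| with hg
  have hg1 : ∀ x, |g x| ≤ 1 := fun x => by
    rw [hg, abs_div, abs_abs]; exact div_self_le_one _
  have hgL2 : MemLp g 2 (volume.restrict (Icc a b)) := by
    have hm := (((hcont t ht).sub (hcont s hs)).aestronglyMeasurable
      (μ := volume) measurableSet_Icc).aemeasurable
    exact MemLp.of_bound (hm.div hm.abs).aestronglyMeasurable 1
      (ae_of_all _ fun x => hg1 x)
  have hgu : ∀ τ, 0 ≤ τ → IntervalIntegrable (fun x => u τ x * g x) volume a b := fun τ hτ =>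
    (hcont τ hτ).memLp_Icc.intervalIntegrable_mul hab.le hgL2
  set κ := ε / (2 * c * d) with hκ
  have hκ0 : 0 < κ := by positivity
  -- `Θ` is nonincreasing, and `Θ t ≤ Θ s` is the claim. With `κ = ε / (2 c d)` the dissipated
  -- energy covers the first term of `|u_t| ≤ u_t² / (2 c) + c / 2`, and the linear term of `Θ`
  -- covers the second.
  set Θ : ℝ → ℝ := fun τ => (∫ x in a..b, u τ x * g x) + κ * energy D f α a b ε (u τ)
    - c * (b - a) / 2 * τ with hΘ
  have hΘc : ContinuousOn Θ (Icc s t) := by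
    intro τ hτ
    have hτ0 : 0 ≤ τ := hs.trans hτ.1
    have hsub : Icc s t ⊆ Ici 0 := fun σ hσ => hs.trans hσ.1
    have h1 : Tendsto (fun σ => ∫ x in a..b, u σ x * g x) (𝓝[Ici 0] τ)
        (𝓝 (∫ x in a..b, u τ x * g x)) := by
      refine tendsto_integral_mul hab.le (eventually_mem_nhdsWithin.mono fun σ hσ =>
        (hcont σ hσ).memLp_Icc) (hcont τ hτ0).memLp_Icc hgL2 ?_
      refine squeeze_zero (fun σ => l2DistSq_nonneg hab.le _ _) (fun σ => ?_)
        (hu.continuous_H1 τ hτ0)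
      exact le_add_of_nonneg_right (l2DistSq_nonneg hab.le _ _)
    have h2 := (h1.add ((hu.tendsto_energy hDf hab hτ0).const_mul κ)).sub
      (((continuous_const.mul continuous_id).tendsto τ).mono_left nhdsWithin_le_nhds
        : Tendsto (fun σ => c * (b - a) / 2 * σ) (𝓝[Ici 0] τ) _)
    exact h2.mono_left (nhdsWithin_mono _ hsub)
  have hslope : ∀ σ ∈ Ioc s t, ∀ η > 0, ∀ᶠ z in 𝓝[<] σ, (Θ σ - Θ z) / (σ - z) ≤ η := by
    intro σ hσ η hη
    have hσ0 : 0 < σ := hs.trans_lt hσ.1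
    obtain ⟨S, hS, hle⟩ := hu.exists_left_slope_energy_le hDf hab hε hσ0
    have hq := hu.tendsto_integral_quotient_mul hDf hab hσ0 hgL2
    set ρ := rhs D f a b ε (u σ)
    have hρ := hu.memLp_rhs hDf hab hσ0
    have hDρ : IntervalIntegrable (fun x => D (u σ x) * ρ x ^ 2) volume a b := by
      refine ((hρ.continuousOn_mul (hDf.continuousOn_D.comp (hcont σ hσ0.le)
        (hu.mem_I σ hσ0.le))).intervalIntegrable_mul hab.le hρ).congr fun x _ => ?_
      change D (u σ x) * ρ x * ρ x = D (u σ x) * ρ x ^ 2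
      ring
    have hρg := hρ.intervalIntegrable_mul hab.le hgL2
    have hlim := (hq.add (hS.const_mul κ)).sub_const (c * (b - a) / 2)
    have hneg : (∫ x in a..b, ρ x * g x) + κ * (-(1 / ε) * ∫ x in a..b, D (u σ x) * ρ x ^ 2)
        - c * (b - a) / 2 ≤ 0 := by
      have hmono := intervalIntegral.integral_mono_on hab.le hρg
        ((hDρ.const_mul (κ / ε)).add (intervalIntegrable_const (c := c / 2))) fun x hx => by
          have h1 : ρ x * g x ≤ |ρ x| := by
            refine (le_abs_self _).trans ?_
            rw [abs_mul]
            exact mul_le_of_le_one_right (abs_nonneg _) (hg1 x)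
          have h2 : d * ρ x ^ 2 ≤ D (u σ x) * ρ x ^ 2 :=
            mul_le_mul_of_nonneg_right (hD _ (hu.mem_I σ hσ0.le x hx)) (sq_nonneg _)
          have h3 : κ / ε * (d * ρ x ^ 2) = |ρ x| ^ 2 / (2 * c) := by
            rw [sq_abs, hκ]; field_simp
          have h4 : |ρ x| ≤ |ρ x| ^ 2 / (2 * c) + c / 2 := by
            have : |ρ x| ^ 2 / (2 * c) + c / 2 - |ρ x| = (|ρ x| - c) ^ 2 / (2 * c) := by
              field_simp; ring
            have : 0 ≤ (|ρ x| - c) ^ 2 / (2 * c) := by positivity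
            linarith
          have h5 := mul_le_mul_of_nonneg_left h2 (div_pos hκ0 hε).le
          linarith
      rw [intervalIntegral.integral_add (hDρ.const_mul _) intervalIntegrable_const,
        intervalIntegral.integral_const_mul, intervalIntegral.integral_const, smul_eq_mul] at hmono
      have : κ * (-(1 / ε) * ∫ x in a..b, D (u σ x) * ρ x ^ 2)
        = -(κ / ε * ∫ x in a..b, D (u σ x) * ρ x ^ 2) := by ring
      linarith
    filter_upwards [hlim.eventually_lt_const (hneg.trans_lt hη), hle, eventually_mem_nhdsWithin,
      nhdsLT_le_nhdsGE hσ0 eventually_mem_nhdsWithin] with z hz hEz hzσ hz0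
    have hpos : 0 < σ - z := sub_pos.2 hzσ
    have e1 : ∫ x in a..b, (u z x - u σ x) / (z - σ) * g x
        = ((∫ x in a..b, u σ x * g x) - ∫ x in a..b, u z x * g x) / (σ - z) := by
      rw [← intervalIntegral.integral_sub (hgu σ hσ0.le) (hgu z hz0), ← intervalIntegral.integral_div]
      refine intervalIntegral.integral_congr fun x _ => ?_
      rw [← neg_sub (u σ x), ← neg_sub σ z, neg_div_neg_eq]
      ring
    have e2 : (Θ σ - Θ z) / (σ - z) = ((∫ x in a..b, u σ x * g x) - ∫ x in a..b, u z x * g x)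
        / (σ - z) + κ * ((energy D f α a b ε (u σ) - energy D f α a b ε (u z)) / (σ - z))
        - c * (b - a) / 2 := by
      rw [hΘ]
      field_simp
      ring
    rw [e2, ← e1]
    linarith [mul_le_mul_of_nonneg_left hEz hκ0.le]
  have hfin := le_of_left_slope_le hst hΘc hslope
  have habs : ∫ x in a..b, |u t x - u s x|
      = (∫ x in a..b, u t x * g x) - ∫ x in a..b, u s x * g x := by
    rw [← intervalIntegral.integral_sub (hgu t ht) (hgu s hs)]
    refine intervalIntegral.integral_congr fun x _ => ?_
    simp only [hg]
    rw [← sub_mul, ← mul_div_assoc, ← abs_mul_abs_self (u t x - u s x), mul_self_div_self]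
  rw [habs]
  simp only [hΘ] at hfin
  linarith

/-- Let `c → 0` in `integral_abs_sub_le`: if the energy grew, the bound for the nonnegative `L¹`
distance would become negative. -/
theorem energy_antitone (hDf : Admissible I α β D f) (hu : IsSolution I D f a b ε u₀ u)
    (hab : a < b) (hε : 0 < ε) {s t : ℝ} (hs : 0 ≤ s) (hst : s ≤ t) :
    energy D f α a b ε (u t) ≤ energy D f α a b ε (u s) := by
  obtain ⟨d, hd, hD⟩ := hDf.D_lower
  by_contra! hlt
  set Δ := energy D f α a b ε (u t) - energy D f α a b ε (u s) with hΔ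
  have hΔ0 : 0 < Δ := sub_pos.2 hlt
  have hlim : Tendsto (fun c => c ^ 2 * ((b - a) * (t - s) * d)) (𝓝[>] 0) (𝓝 0) := by
    have : Tendsto (fun c : ℝ => c ^ 2 * ((b - a) * (t - s) * d)) (𝓝 0) (𝓝 (0 ^ 2 * _)) :=
      (tendsto_id.pow 2).mul_const _
    simp only [ne_eq, OfNat.ofNat_ne_zero, not_false_eq_true, zero_pow, zero_mul] at this
    exact this.mono_left nhdsWithin_le_nhds
  obtain ⟨c, hlt', hc⟩ :=
    ((hlim.eventually_lt_const (mul_pos hε hΔ0)).and self_mem_nhdsWithin).exists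
  have hc : 0 < c := hc
  have h1 := hu.integral_abs_sub_le hDf hab hε hd hD hs hst hc
  have h2 : 0 ≤ ∫ x in a..b, |u t x - u s x| :=
    intervalIntegral.integral_nonneg hab.le fun _ _ => abs_nonneg _
  have h3 : c * (b - a) * (t - s) / 2 + ε / (2 * c * d) *
      (energy D f α a b ε (u s) - energy D f α a b ε (u t))
      = (c ^ 2 * ((b - a) * (t - s) * d) - ε * Δ) / (2 * c * d) := by
    rw [hΔ]; field_simp; ring
  have h4 : (c ^ 2 * ((b - a) * (t - s) * d) - ε * Δ) / (2 * c * d) < 0 :=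
    div_neg_of_neg_of_pos (by linarith) (by positivity)
  linarith

end IsSolution

/-! ### Persistence for exponentially long times -/

theorem energy_congr {D f : ℝ → ℝ} {α a b ε : ℝ} (hab : a ≤ b) {w z : ℝ → ℝ}
    (h : ∀ x ∈ Icc a b, w x = z x) : energy D f α a b ε w = energy D f α a b ε z := by
  refine intervalIntegral.integral_congr fun x hx => ?_
  rw [uIcc_of_le hab] at hx
  have hdx : dx a b w x = dx a b z x := derivWithin_congr h (h x hx)
  simp only [h x hx, hdx]

theorem tendsto_exp_neg_div_nhdsGT {A : ℝ} (hA : 0 < A) :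
    Tendsto (fun ε => Real.exp (-A / ε)) (𝓝[>] 0) (𝓝 0) := by
  refine Real.tendsto_exp_atBot.comp (Tendsto.congr (fun ε => (div_eq_mul_inv (-A) ε).symm) ?_)
  exact tendsto_inv_nhdsGT_zero.const_mul_atTop_of_neg (neg_lt_zero.2 hA)

theorem IsSolution.continuousOn_integral_abs_sub {I : Set ℝ} {D f : ℝ → ℝ} {a b ε : ℝ}
    {u₀ : ℝ → ℝ} {u : ℝ → ℝ → ℝ} (hu : IsSolution I D f a b ε u₀ u) (hab : a < b) :
    ContinuousOn (fun t => ∫ x in a..b, |u t x - u 0 x|) (Ici 0) := by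
  intro t₀ ht₀
  change Tendsto _ _ _
  rw [tendsto_iff_dist_tendsto_zero]
  refine squeeze_zero' (Eventually.of_forall fun _ => dist_nonneg) ?_
    (hu.tendsto_integral_abs_sub hab ht₀)
  filter_upwards [eventually_mem_nhdsWithin] with t ht
  have i1 := hu.intervalIntegrable_abs_sub hab ht le_rfl
  have i2 := hu.intervalIntegrable_abs_sub hab ht₀ le_rfl
  rw [Real.dist_eq, ← intervalIntegral.integral_sub i1 i2]
  refine (intervalIntegral.abs_integral_le_integral_abs hab.le).trans
    (intervalIntegral.integral_mono_on hab.le (i1.sub i2).abs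
      (hu.intervalIntegrable_abs_sub hab ht ht₀) fun x _ => ?_)
  refine (abs_abs_sub_abs_le_abs_sub _ _).trans_eq ?_
  rw [sub_sub_sub_cancel_right]

section Persistence

variable {I : Set ℝ} {α β : ℝ} {D f : ℝ → ℝ} {a b r A : ℝ} {N : ℕ} {h : Fin N → ℝ} {v : ℝ → ℝ}

/-- A bootstrap: a distance at most `τ / 2` allows the energy lower bound at time `t`, which limits
the energy drop and so improves the distance to strictly less than `τ / 2`. By continuity in time
the value `τ / 2` is never attained. -/
theorem IsSolution.integral_abs_sub_lt (hDf : Admissible I α β D f) (hab : a < b)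
    (hv : IsStepFunction a b α β N h r v) {δ C C' d ε τ : ℝ} (hε : 0 < ε) (hd : 0 < d)
    (hD : ∀ y ∈ I, d ≤ D y)
    (hlow : ∀ w, MemH1 a b w → (∀ x ∈ Icc a b, w x ∈ I) → ∫ x in a..b, |w x - v x| ≤ δ →
      N * gammaZero D f α β - C' * Real.exp (-A / ε) ≤ energy D f α a b ε w)
    {u₀ : ℝ → ℝ} {u : ℝ → ℝ → ℝ} (hu : IsSolution I D f a b ε u₀ u)
    (hE : energy D f α a b ε (u 0) ≤ N * gammaZero D f α β + C * Real.exp (-A / ε))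
    (hτ : τ ≤ δ) (hL1 : ∫ x in a..b, |u 0 x - v x| ≤ τ / 2)
    (hsmall : Real.sqrt ε * ((b - a) + (C + C') / (2 * d)) < τ / 2) {t : ℝ}
    (ht : t ∈ Icc 0 (2 * Real.exp (A / ε))) :
    ∫ x in a..b, |u t x - u 0 x| < τ / 2 ∧ ∫ x in a..b, |u t x - v x| ≤ τ := by
  have hab0 : 0 < b - a := sub_pos.2 hab
  have htri : ∀ t, 0 ≤ t → ∫ x in a..b, |u t x - v x| ≤
      (∫ x in a..b, |u t x - u 0 x|) + ∫ x in a..b, |u 0 x - v x| := fun t ht => by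
    have i1 := hu.intervalIntegrable_abs_sub hab ht le_rfl
    have i2 := hv.intervalIntegrable_abs_sub hab.le (hu.continuousOn_slice hab le_rfl)
    rw [← intervalIntegral.integral_add i1 i2]
    exact intervalIntegral.integral_mono_on hab.le
      (hv.intervalIntegrable_abs_sub hab.le (hu.continuousOn_slice hab ht)) (i1.add i2)
      fun x _ => abs_sub_le _ _ _
  have himp : ∀ t ∈ Icc 0 (2 * Real.exp (A / ε)), ∫ x in a..b, |u t x - u 0 x| ≤ τ / 2 →
      ∫ x in a..b, |u t x - u 0 x| < τ / 2 := by
    intro t ht hle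
    have h1 := hlow (u t) (hu.memH1 t ht.1) (hu.mem_I t ht.1) (by linarith [htri t ht.1])
    have hexp : Real.exp (A / ε) * Real.exp (-A / ε) = 1 := by
      rw [← Real.exp_add, neg_div, add_neg_cancel, Real.exp_zero]
    have he := Real.exp_pos (-A / ε)
    have hs : 0 < Real.sqrt ε := Real.sqrt_pos.2 hε
    -- With `c = √ε exp(-A / ε)` the time term (times up to `2 exp(A / ε)`) and the energy term (a
    -- drop of order `exp(-A / ε)`) are both of order `√ε`.
    have h2 := hu.integral_abs_sub_le hDf hab hε hd hD le_rfl ht.1 (mul_pos hs he)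
    have h3 : Real.sqrt ε * Real.exp (-A / ε) * (b - a) * (t - 0) / 2
        ≤ Real.sqrt ε * (b - a) := by
      have h4 := mul_le_mul_of_nonneg_left ht.2
        (show 0 ≤ Real.sqrt ε * Real.exp (-A / ε) * (b - a) / 2 by positivity)
      calc _ = Real.sqrt ε * Real.exp (-A / ε) * (b - a) / 2 * t := by ring
        _ ≤ _ := h4
        _ = Real.sqrt ε * (b - a) * (Real.exp (A / ε) * Real.exp (-A / ε)) := by ring
        _ = _ := by rw [hexp, mul_one]
    have h5 : ε / (2 * (Real.sqrt ε * Real.exp (-A / ε)) * d) *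
        (energy D f α a b ε (u 0) - energy D f α a b ε (u t))
        ≤ Real.sqrt ε * ((C + C') / (2 * d)) := by
      have h6 : energy D f α a b ε (u 0) - energy D f α a b ε (u t)
          ≤ (C + C') * Real.exp (-A / ε) := by linarith
      refine (mul_le_mul_of_nonneg_left h6 (by positivity)).trans_eq ?_
      have hsq : ε = Real.sqrt ε * Real.sqrt ε := (Real.mul_self_sqrt hε.le).symm
      have h7 : ε / (2 * (Real.sqrt ε * Real.exp (-A / ε)) * d) * ((C + C') * Real.exp (-A / ε))
          = ε / Real.sqrt ε * ((C + C') / (2 * d)) := by field_simp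
      rw [h7, Real.div_sqrt]
    linarith
  have hlt : ∫ x in a..b, |u t x - u 0 x| < τ / 2 := by
    refine himp t ht ?_
    by_contra! hgt
    have h0 : ∫ x in a..b, |u 0 x - u 0 x| = 0 := by simp
    have hτ0 : 0 ≤ τ / 2 :=
      (intervalIntegral.integral_nonneg hab.le fun _ _ => abs_nonneg _).trans hL1
    obtain ⟨t', ht', ht'eq⟩ := intermediate_value_Icc ht.1
      ((hu.continuousOn_integral_abs_sub hab).mono Icc_subset_Ici_self)
      (show τ / 2 ∈ Icc (∫ x in a..b, |u 0 x - u 0 x|) (∫ x in a..b, |u t x - u 0 x|) from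
        ⟨h0.trans_le hτ0, hgt.le⟩)
    have := himp t' ⟨ht'.1, ht'.2.trans ht.2⟩ ht'eq.le
    exact absurd ht'eq this.ne
  exact ⟨hlt, by linarith [htri t ht.1]⟩

/-- The transition layers persist for exponentially long times. -/
theorem HasTransitionLayers.eventually_persist (hDf : Admissible I α β D f) (hab : a < b)
    (hv : IsStepFunction a b α β N h r v) (hA : A ∈ Ioo 0 (r * Real.sqrt (2 * lam D f α β)))
    {u₀ : ℝ → ℝ → ℝ} {u : ℝ → ℝ → ℝ → ℝ} (hu₀ : HasTransitionLayers I D f α β a b N v A u₀)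
    (hu : ∀ᶠ ε in 𝓝[>] (0 : ℝ), IsSolution I D f a b ε (u₀ ε) (u ε)) {σ : ℝ} (hσ : 0 < σ) :
    ∀ᶠ ε in 𝓝[>] (0 : ℝ), ∀ t ∈ Icc 0 (2 * Real.exp (A / ε)),
      ∫ x in a..b, |u ε t x - v x| ≤ σ ∧
      energy D f α a b ε (u ε t) ≤ N * gammaZero D f α β + σ := by
  obtain ⟨δ, hδ, C', hC', hlow⟩ := hDf.exists_energy_lower_bound hab hv hA
  obtain ⟨C, hC, hE⟩ := hu₀.energy_le
  obtain ⟨d, hd, hD⟩ := hDf.D_lower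
  have hτ : 0 < min δ σ := lt_min hδ hσ
  have h1 : ∀ᶠ ε in 𝓝[>] (0 : ℝ), C * Real.exp (-A / ε) < σ := by
    have := (tendsto_exp_neg_div_nhdsGT hA.1).const_mul C
    rw [mul_zero] at this
    exact this.eventually_lt_const hσ
  have h2 : ∀ᶠ ε in 𝓝[>] (0 : ℝ),
      Real.sqrt ε * ((b - a) + (C + C') / (2 * d)) < min δ σ / 2 := by
    have : Tendsto (fun ε => Real.sqrt ε * ((b - a) + (C + C') / (2 * d))) (𝓝 0)
        (𝓝 (Real.sqrt 0 * _)) := (Real.continuous_sqrt.tendsto 0).mul_const _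
    rw [Real.sqrt_zero, zero_mul] at this
    exact (this.mono_left nhdsWithin_le_nhds).eventually_lt_const (half_pos hτ)
  filter_upwards [hu, hE, h1, h2, hu₀.tendsto_L1.eventually_lt_const (half_pos hτ),
    eventually_mem_nhdsWithin] with ε hu hE h1 h2 hL1 hε t ht
  have hE0 : energy D f α a b ε (u ε 0) ≤ N * gammaZero D f α β + C * Real.exp (-A / ε) := by
    rwa [energy_congr hab.le hu.initial]
  have hL10 : ∫ x in a..b, |u ε 0 x - v x| ≤ min δ σ / 2 := by
    refine le_of_eq_of_le (intervalIntegral.integral_congr fun x hx => ?_) hL1.le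
    rw [uIcc_of_le hab.le] at hx
    simp only [hu.initial x hx]
  refine ⟨((hu.integral_abs_sub_lt hDf hab hv hε hd hD (hlow ε hε) hE0 (min_le_left _ _) hL10 h2
    ht).2).trans (min_le_right _ _), ?_⟩
  linarith [hu.energy_antitone hDf hab hε le_rfl ht.1]

end Persistence

/-! ### Hausdorff distance of interfaces -/

section Interface

variable {I : Set ℝ} {α β : ℝ} {D f : ℝ → ℝ} {a b r : ℝ} {N : ℕ} {h : Fin N → ℝ} {v : ℝ → ℝ}

theorem exists_dist_lt_notMem {I K : Set ℝ} (hK : IsClosed ((fun x : I => (x : ℝ)) ⁻¹' K)) {c : ℝ}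
    (hc : c ∈ I) (hcK : c ∉ K) : ∃ η > 0, ∀ y ∈ I, |y - c| < η → y ∉ K := by
  obtain ⟨η, hη, hball⟩ := Metric.isOpen_iff.1 hK.isOpen_compl ⟨c, hc⟩ hcK
  exact ⟨η, hη, fun y hy hyc => hball (show dist (⟨y, hy⟩ : I) ⟨c, hc⟩ < η from hyc)⟩

/-- The interfaces of two functions that are close to the same step function and whose energies do
not exceed `N γ₀` by much have small Hausdorff distance. -/
theorem Admissible.exists_hausdorffEDist_interface_le (hDf : Admissible I α β D f) (hab : a < b)
    (hN : 1 ≤ N) (hv : IsStepFunction a b α β N h r v) {δ : ℝ} (hδ : δ ∈ Ioo 0 r) {K : Set ℝ}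
    (hKI : K ⊆ I \ {α, β}) (hK : IsClosed ((fun x : I => (x : ℝ)) ⁻¹' K)) :
    ∃ σ > 0, ∀ ε > 0, ∀ w z,
      (MemH1 a b w ∧ (∀ x ∈ Icc a b, w x ∈ I) ∧ ∫ x in a..b, |w x - v x| ≤ σ ∧
        energy D f α a b ε w ≤ N * gammaZero D f α β + σ) →
      (MemH1 a b z ∧ (∀ x ∈ Icc a b, z x ∈ I) ∧ ∫ x in a..b, |z x - v x| ≤ σ ∧
        energy D f α a b ε z ≤ N * gammaZero D f α β + σ) →
      Metric.hausdorffEDist (interface a b K w) (interface a b K z) ≤ ENNReal.ofReal δ := by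
  -- Each interface is located within `δ / 2` of the jumps, so that two of them differ by at most
  -- `δ`.
  have hδ2 : δ / 2 ∈ Ioo 0 r := ⟨half_pos hδ.1, by linarith [hδ.1, hδ.2]⟩
  obtain ⟨η₁, hη₁, hK1⟩ := exists_dist_lt_notMem hK hDf.left_mem fun h => (hKI h).2 (by simp)
  obtain ⟨η₂, hη₂, hK2⟩ := exists_dist_lt_notMem hK hDf.right_mem fun h => (hKI h).2 (by simp)
  obtain ⟨κ₁, hκ₁, hF1⟩ := hDf.exists_lt_of_calib hDf.left_mem hη₁
  obtain ⟨κ₂, hκ₂, hF2⟩ := hDf.exists_lt_of_calib hDf.right_mem hη₂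
  rw [calib_left] at hF1
  rw [calib_right] at hF2
  obtain ⟨σ, hσ, hloc⟩ := hDf.exists_localization hab hN hv hδ2 (lt_min hκ₁ hκ₂)
  have hη := lt_min hη₁ hη₂
  have hmin1 := min_le_left κ₁ κ₂
  have hmin2 := min_le_right κ₁ κ₂
  refine ⟨min σ (min η₁ η₂ / 2 * (δ / 2)), lt_min hσ (mul_pos (half_pos hη) hδ2.1), ?_⟩
  intro ε hε
  -- Whether `K` meets `(α, β)` is independent of `w`. If it does, continuity puts an interface
  -- point near each jump; if not, both interfaces are empty, and an interface point of one function
  -- would contradict this.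
  have hnear : ∀ w, (MemH1 a b w ∧ (∀ x ∈ Icc a b, w x ∈ I) ∧
      ∫ x in a..b, |w x - v x| ≤ min σ (min η₁ η₂ / 2 * (δ / 2)) ∧
      energy D f α a b ε w ≤ N * gammaZero D f α β + min σ (min η₁ η₂ / 2 * (δ / 2))) →
      (∀ x ∈ interface a b K w, ∃ i, |x - h i| < δ / 2 ∧ (K ∩ Ioo α β).Nonempty) ∧
      ((K ∩ Ioo α β).Nonempty → ∀ i, ∃ x ∈ interface a b K w, |x - h i| < δ / 2) := by
    rintro w ⟨hw, hwI, hL1, hE⟩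
    have hw' := hloc ε hε w hw hwI (hL1.trans (min_le_left _ _))
      (hE.trans (add_le_add_right (min_le_left _ _) _))
    constructor
    · rintro x ⟨hx, hxK⟩
      obtain ⟨⟨hlo, hhi⟩, hfar⟩ := hw' x hx
      have hxI := hwI x hx
      have hxα : η₁ ≤ |w x - α| := le_of_not_gt fun hlt => hK1 _ hxI hlt hxK
      have hxβ : η₂ ≤ |w x - β| := le_of_not_gt fun hlt => hK2 _ hxI hlt hxK
      have h1 : α - η₁ < w x := (hF1 _ hxI).1 (by linarith)
      have h2 : w x < β + η₂ := (hF2 _ hxI).2 (by linarith)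
      -- `w x` lies in `(α - η₁, β + η₂)` by localization, but at least `η₁` from `α` and `η₂` from
      -- `β` because it is in `K`.
      have hxmem : w x ∈ Ioo α β := by
        constructor
        · rcases le_abs.1 hxα with h | h <;> linarith
        · rcases le_abs.1 hxβ with h | h <;> linarith
      by_contra! hcon
      have hfar' : ∀ i, δ / 2 ≤ |x - h i| := fun i => le_of_not_gt fun hlt =>
        (hcon i hlt).subset ⟨hxK, hxmem⟩
      rcases hfar hfar' with h | h
      · have h := abs_lt.1 h
        have h3 := (hF1 _ hxI).2 (by linarith)
        exact absurd (abs_lt.2 ⟨by linarith, by linarith⟩) hxα.not_gt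
      · have h := abs_lt.1 h
        have h3 := (hF2 _ hxI).1 (by linarith)
        exact absurd (abs_lt.2 ⟨by linarith, by linarith⟩) hxβ.not_gt
    · rintro ⟨k, hkK, hk⟩ i
      have hkI := (hKI hkK).1
      have hkα : η₁ ≤ |k - α| := le_of_not_gt fun hlt => hK1 _ hkI hlt hkK
      have hkβ : η₂ ≤ |k - β| := le_of_not_gt fun hlt => hK2 _ hkI hlt hkK
      rw [abs_of_pos (sub_pos.2 hk.1)] at hkα
      rw [abs_of_neg (sub_neg.2 hk.2)] at hkβ
      have hwc := hw.continuousOn hab.le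
      obtain ⟨x, hx, y, hy, hxy⟩ := hv.exists_layer_points hab.le hwc hδ2.1 hδ2.2.le
        (hL1.trans (min_le_right _ _)) i
      have hm1 := min_le_left η₁ η₂
      have hm2 := min_le_right η₁ η₂
      have hsub : Icc x y ⊆ Icc a b := Icc_subset_Icc (by linarith [hv.left_le i, hx.1, hδ2.2])
        (by linarith [hv.le_right i, hy.2, hδ2.2])
      have hxy' : x ≤ y := by linarith [hx.2, hy.1]
      obtain ⟨p, hp, hpk⟩ : ∃ p ∈ Icc x y, w p = k := by
        rcases hxy with ⟨h1, h2⟩ | ⟨h1, h2⟩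
        · have h1 := abs_le.1 h1
          have h2 := abs_le.1 h2
          exact intermediate_value_Icc hxy' (hwc.mono hsub) ⟨by linarith, by linarith⟩
        · have h1 := abs_le.1 h1
          have h2 := abs_le.1 h2
          exact intermediate_value_Icc' hxy' (hwc.mono hsub) ⟨by linarith, by linarith⟩
      exact ⟨p, ⟨hsub hp, hpk ▸ hkK⟩, abs_lt.2 ⟨by linarith [hp.1, hx.1], by linarith [hp.2, hy.2]⟩⟩
  have hclose : ∀ w z, _ → _ → ∀ x ∈ interface a b K w, ∃ y ∈ interface a b K z,
      edist x y ≤ ENNReal.ofReal δ := fun w z hw hz x hx => by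
    obtain ⟨i, hi, hne⟩ := (hnear w hw).1 x hx
    obtain ⟨y, hy, hyi⟩ := (hnear z hz).2 hne i
    refine ⟨y, hy, ?_⟩
    rw [edist_dist]
    refine ENNReal.ofReal_le_ofReal ?_
    rw [Real.dist_eq]
    have h1 := abs_lt.1 hi
    have h2 := abs_lt.1 hyi
    exact abs_le.2 ⟨by linarith, by linarith⟩
  exact fun w z hw hz => Metric.hausdorffEDist_le_of_mem_edist (hclose w z hw hz) (hclose z w hz hw)

end Interface

end AllenCahn

theorem mainTheorem4
    (I : Set ℝ) (α β : ℝ) (D f : ℝ → ℝ) (hDf : AllenCahn.Admissible I α β D f)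
    (a b : ℝ) (hab : a < b)
    (N : ℕ) (hN : 1 ≤ N) (h : Fin N → ℝ) (r : ℝ) (v : ℝ → ℝ)
    (hv : AllenCahn.IsStepFunction a b α β N h r v)
    (A : ℝ) (hA : A ∈ Set.Ioo 0 (r * Real.sqrt (2 * AllenCahn.lam D f α β)))
    (M₁ M₂ : ℝ) (hM : M₁ < M₂) (hMI : Set.Icc M₁ M₂ ⊆ I)
    (u₀ : ℝ → ℝ → ℝ) (u : ℝ → ℝ → ℝ → ℝ)
    (hu₀M : ∀ᶠ ε in 𝓝[>] (0 : ℝ), ∀ x ∈ Set.Icc a b, u₀ ε x ∈ Set.Icc M₁ M₂)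
    (hu₀ : AllenCahn.HasTransitionLayers I D f α β a b N v A u₀)
    (hu : ∀ᶠ ε in 𝓝[>] (0 : ℝ), AllenCahn.IsSolution I D f a b ε (u₀ ε) (u ε))
    (δ₁ : ℝ) (hδ₁ : δ₁ ∈ Set.Ioo 0 r)
    (K : Set ℝ) (hKI : K ⊆ I \ {α, β})
    (hK : IsClosed ((fun x : I => (x : ℝ)) ⁻¹' K)) :
    ∃ ε₀ : ℝ, 0 < ε₀ ∧ ∀ ε ∈ Set.Ioo 0 ε₀,
      ((Real.exp (A / ε) : ℝ) : EReal) < AllenCahn.exitTime a b K δ₁ (u₀ ε) (u ε) := by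
  obtain ⟨σ, hσ, hhaus⟩ := hDf.exists_hausdorffEDist_interface_le hab hN hv hδ₁ hKI hK
  have hev := (hu₀.eventually_persist hDf hab hv hA hu hσ).and hu
  obtain ⟨ε₀, hε₀, hsub⟩ := mem_nhdsGT_iff_exists_Ioo_subset.1 hev
  refine ⟨ε₀, hε₀, fun ε hε => ?_⟩
  obtain ⟨hpers, huε⟩ := hsub hε
  have hexp := Real.exp_pos (A / ε)
  have hinit : AllenCahn.interface a b K (u₀ ε) = AllenCahn.interface a b K (u ε 0) := by
    ext x
    exact and_congr_right fun hx => by rw [huε.initial x hx]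
  -- Persistence holds up to twice the required time, so the infimum is strictly larger than `exp(A
  -- / ε)`.
  have hlt : ((Real.exp (A / ε) : ℝ) : EReal) < ((2 * Real.exp (A / ε) : ℝ) : EReal) :=
    EReal.coe_lt_coe_iff.2 (by linarith)
  refine hlt.trans_le (le_sInf ?_)
  rintro _ ⟨t, ⟨ht0, ht⟩, rfl⟩
  refine EReal.coe_le_coe_iff.2 (le_of_not_gt fun htT => ht.not_ge ?_)
  rw [hinit]
  exact hhaus ε hε.1 _ _
    ⟨huε.memH1 t ht0, huε.mem_I t ht0, hpers t ⟨ht0, htT.le⟩⟩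
    ⟨huε.memH1 0 le_rfl, huε.mem_I 0 le_rfl, hpers 0 ⟨le_rfl, by positivity⟩⟩
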